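/- Let $t\in\mathbb R$ be fixed, and let $P_n(x;t)$, $n=0,1,2,\dots$, be the monic polynomials of degree $n$ that are orthogonal on $\mathbb R$ with respect to the sextic Freud weight $w(x;t)=e^{-x^6+tx^2}$, i.e. $\int_{-\infty}^{\infty}P_j(x;t)P_k(x;t)w(x;t)\,dx=h_j(t)\,\delta_{jk}$. Let $\mathrm p(n,t)$ denote the coefficient of $x^{n-2}$ in $P_n(x;t)$ (with $\mathrm p(0,t)=\mathrm p(1,t)=0$), and let $\beta_n=\beta_n(t)$ be the recurrence coefficients, defined by $xP_n=P_{n+1}+\beta_nP_{n-1}$ for $n\ge 1$ and $\beta_j=0$ for $j\le 0$. Then: (i) For every $n\ge 0$, $$\begin{aligned}\mathrm p(n,t)=\tfrac12\beta_n\big[&1+2t\beta_n-6\beta_n^2(\beta_{n-1}+\beta_n+\beta_{n+1})-6(\beta_n+\beta_{n+1})\beta_{n-1}(\beta_{n-2}+\beta_{n-1}+\beta_n)\\&-6(\beta_{n-1}+\beta_n)\beta_{n+1}(\beta_n+\beta_{n+1}+\beta_{n+2})\big].\end{aligned}$$ (ii) As $n\to\infty$, $$\begin{aligned}\mathrm p(n,t)=&-\frac{3n^{4/3}}{4\sqrt[3]{60}}-\frac{n^{2/3}t}{2\sqrt[3]{450}}+\frac{n^{1/3}}{2\sqrt[3]{60}}-\frac{t^2}{90}+\frac{t}{6\sqrt[3]{450}\,n^{1/3}}-\frac{2t^3-45}{810\sqrt[3]{60}\,n^{2/3}}\\&+\frac{t^4}{2430\sqrt[3]{450}\,n^{4/3}}-\frac{4t^3-135}{4860\sqrt[3]{60}\,n^{5/3}}+O(n^{-2}),\end{aligned}$$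 where the constant in $O(n^{-2})$ may depend on $t$. -/

import Mathlib

open MeasureTheory Polynomial Filter Asymptotics

noncomputable section

namespace SexticFreud

/-- The sextic Freud weight `w(x;t) = exp(-x^6 + t x^2)` on the real line. -/
def weight (t x : ℝ) : ℝ := Real.exp (-x ^ 6 + t * x ^ 2)

/-- The inner product `∫ p(x) q(x) w(x;t) dx` of two real polynomials. -/
def ip (t : ℝ) (p q : ℝ[X]) : ℝ := ∫ x : ℝ, p.eval x * q.eval x * weight t x

/-- The monic orthogonal polynomials `P_n(x;t)`, obtained from `1, x, x^2, …` by the Gram–Schmidt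
process. The lemmas below show that `P_n` is monic of degree `n`, that the `P_n` are mutually
orthogonal, and that no other sequence has these properties. -/
def P (t : ℝ) : ℕ → ℝ[X]
  | n => X ^ n - ∑ k : Fin n, C (ip t (X ^ n) (P t k) / ip t (P t k) (P t k)) * P t k

/-- `h_n(t) = ∫ P_n(x;t)^2 w(x;t) dx`. -/
def h (t : ℝ) (n : ℕ) : ℝ := ip t (P t n) (P t n)

/-- The coefficient `p(n,t)` of `x^(n-2)` in `P_n(x;t)`, with `p(0,t) = p(1,t) = 0`. -/
def p (n : ℕ) (t : ℝ) : ℝ := if n < 2 then 0 else (P t n).coeff (n - 2)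

/-- The recurrence coefficient `β_n(t)`: the coefficient of `P_{n-1}` in the orthogonal expansion
of `x P_n`, with `β_0 = 0`. See `three_term_recurrence`.
Since `0 - 1 = 0` in `ℕ`, reading `beta t (n - 1)` and `beta t (n - 2)` for small `n` amounts to the
convention `β_j = 0` for `j ≤ 0`. -/
def beta (t : ℝ) : ℕ → ℝ
  | 0 => 0
  | n + 1 => ip t (X * P t (n + 1)) (P t n) / h t n

lemma weight_pos (t x : ℝ) : 0 < weight t x := Real.exp_pos _

lemma continuous_weight (t : ℝ) : Continuous (weight t) := by
  unfold weight; fun_prop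

lemma weight_le (t : ℝ) : ∃ K : ℝ, ∀ x, weight t x ≤ K * Real.exp (-1 * x ^ 2) := by
  refine ⟨Real.exp (|t + 1| * (1 + |t + 1|)), fun x => ?_⟩
  rw [← Real.exp_add]
  apply Real.exp_le_exp.2
  set a := |t + 1| with ha
  have h0 : 0 ≤ a := abs_nonneg _
  have h1 : t + 1 ≤ a := le_abs_self _
  set y := x ^ 2 with hy
  have hy0 : 0 ≤ y := sq_nonneg x
  have hx : x ^ 6 = y ^ 3 := by rw [hy]; ring
  have h2 : (t + 1) * y ≤ a * y := mul_le_mul_of_nonneg_right h1 hy0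
  have h3 : a * y ≤ y ^ 3 + a * (1 + a) := by
    by_cases hc : y ≤ 1 + a
    · have := mul_le_mul_of_nonneg_left hc h0
      have := pow_nonneg hy0 3
      linarith
    · push Not at hc
      have h4 : a ≤ y ^ 2 := by nlinarith
      have h5 := mul_le_mul_of_nonneg_right h4 hy0
      have h6 : 0 ≤ a * (1 + a) := by positivity
      nlinarith
  rw [hx]
  linarith

lemma integrable_weight (t : ℝ) (q : ℝ[X]) : Integrable (fun x => q.eval x * weight t x) := by
  induction q using Polynomial.induction_on' with
  | add a b ha hb =>
    refine (ha.add hb).congr (ae_of_all _ fun x => ?_)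
    simp [add_mul]
  | monomial n c =>
    obtain ⟨K, hK⟩ := weight_le t
    have h1 : Integrable (fun x : ℝ => x ^ n * Real.exp (-1 * x ^ 2)) := by
      have := integrable_rpow_mul_exp_neg_mul_sq (b := 1) one_pos (s := n)
        (by have := n.cast_nonneg (α := ℝ); linarith)
      simpa using this
    have h2 := (h1.const_mul (c * K)).norm
    refine h2.mono' ?_ ?_
    · exact ((Polynomial.continuous _).mul (continuous_weight t)).aestronglyMeasurable
    · refine ae_of_all _ fun x => ?_
      have hw := (weight_pos t x).le
      have hK0 : 0 ≤ K * Real.exp (-1 * x ^ 2) := hw.trans (hK x)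
      calc ‖(monomial n c).eval x * weight t x‖ = ‖c * x ^ n‖ * weight t x := by
            rw [eval_monomial, norm_mul, Real.norm_of_nonneg hw]
        _ ≤ ‖c * x ^ n‖ * (K * Real.exp (-1 * x ^ 2)) := by gcongr; exact hK x
        _ = ‖c * K * (x ^ n * Real.exp (-1 * x ^ 2))‖ := by
            conv_lhs => rw [← Real.norm_of_nonneg hK0, ← norm_mul]
            congr 1; ring

lemma integrable_ip (t : ℝ) (a b : ℝ[X]) :
    Integrable (fun x => a.eval x * b.eval x * weight t x) := by
  simpa using integrable_weight t (a * b)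

lemma ip_comm (t : ℝ) (a b : ℝ[X]) : ip t a b = ip t b a := by
  unfold ip; simp only [mul_comm]

lemma ip_mul_left (t : ℝ) (a b c : ℝ[X]) : ip t (a * b) c = ip t b (a * c) := by
  unfold ip; congr 1; ext x; simp only [eval_mul]; ring

lemma ip_add_left (t : ℝ) (a b c : ℝ[X]) : ip t (a + b) c = ip t a c + ip t b c := by
  unfold ip
  rw [← integral_add (integrable_ip t a c) (integrable_ip t b c)]
  congr 1; ext x; simp only [eval_add]; ring

lemma ip_C_mul_left (t r : ℝ) (a b : ℝ[X]) : ip t (C r * a) b = r * ip t a b := by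
  unfold ip
  rw [← integral_const_mul]
  congr 1; ext x; simp only [eval_mul, eval_C]; ring

/-- The inner product with a fixed second argument, as a linear map. -/
def ipL (t : ℝ) (b : ℝ[X]) : ℝ[X] →ₗ[ℝ] ℝ where
  toFun a := ip t a b
  map_add' a a' := ip_add_left t a a' b
  map_smul' r a := by simp [smul_eq_C_mul, ip_C_mul_left]

lemma ipL_apply (t : ℝ) (a b : ℝ[X]) : ipL t b a = ip t a b := rfl

lemma ip_self_nonneg (t : ℝ) (a : ℝ[X]) : 0 ≤ ip t a a :=
  integral_nonneg fun x => mul_nonneg (mul_self_nonneg _) (weight_pos t x).le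

lemma ip_self_pos (t : ℝ) {a : ℝ[X]} (ha : a ≠ 0) : 0 < ip t a a := by
  obtain ⟨x, hx⟩ : ∃ x, a.eval x ≠ 0 := by
    by_contra! hc
    exact ha (Polynomial.funext (by simpa using hc))
  have hc : Continuous fun x => a.eval x * a.eval x * weight t x :=
    ((Polynomial.continuous a).mul (Polynomial.continuous a)).mul (continuous_weight t)
  refine integral_pos_of_integrable_nonneg_nonzero (x := x) hc (integrable_ip t a a) ?_ ?_
  · intro y; exact mul_nonneg (mul_self_nonneg _) (weight_pos t y).le
  · exact mul_ne_zero (mul_self_ne_zero.2 hx) (weight_pos t x).ne'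

lemma P_eq (t : ℝ) (n : ℕ) :
    P t n = X ^ n - ∑ k : Fin n, C (ip t (X ^ n) (P t k) / ip t (P t k) (P t k)) * P t k := by
  rw [P]

lemma P_monic_degree (t : ℝ) (n : ℕ) : (P t n).Monic ∧ (P t n).degree = n := by
  induction n using Nat.strong_induction_on with
  | _ n ih =>
    have hs : (∑ k : Fin n, C (ip t (X ^ n) (P t k) / ip t (P t k) (P t k)) * P t k).degree
        < ((X : ℝ[X]) ^ n).degree := by
      rw [degree_X_pow]
      refine (degree_sum_le _ _).trans_lt ((Finset.sup_lt_iff (WithBot.bot_lt_coe n)).2 ?_)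
      intro k _
      have hle := degree_mul_le_of_le
        (degree_C_le (a := ip t (X ^ n) (P t k) / ip t (P t k) (P t k))) (ih k k.2).2.le
      refine hle.trans_lt ?_
      rw [zero_add]
      exact WithBot.coe_lt_coe.2 k.2
    rw [P_eq]
    exact ⟨(monic_X_pow n).sub_of_left hs, by rw [degree_sub_eq_left_of_degree_lt hs, degree_X_pow]⟩

lemma P_monic (t : ℝ) (n : ℕ) : (P t n).Monic := (P_monic_degree t n).1

lemma P_degree (t : ℝ) (n : ℕ) : (P t n).degree = n := (P_monic_degree t n).2

lemma h_pos (t : ℝ) (n : ℕ) : 0 < h t n := ip_self_pos t (P_monic t n).ne_zero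

lemma P_orthogonal_lt (t : ℝ) (n : ℕ) : ∀ k < n, ip t (P t n) (P t k) = 0 := by
  induction n using Nat.strong_induction_on with
  | _ n ih =>
    intro k hk
    rw [← ipL_apply, P_eq t n, map_sub, map_sum]
    rw [Finset.sum_eq_single (⟨k, hk⟩ : Fin n)]
    · simp only [ipL_apply, ip_C_mul_left]
      have := (h_pos t k).ne'
      unfold h at this
      field_simp
      simp
    · intro j _ hj
      have hjk : (j : ℕ) ≠ k := fun hh => hj (Fin.ext hh)
      rw [ipL_apply, ip_C_mul_left]
      rcases lt_or_gt_of_ne hjk with hlt | hgt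
      · rw [ip_comm t (P t j) (P t k), ih k hk j hlt, mul_zero]
      · rw [ih j j.2 k hgt, mul_zero]
    · intro hh; exact absurd (Finset.mem_univ _) hh

/-- The orthogonality relation `∫ P_j P_k w dx = h_j δ_{jk}`. -/
lemma P_orthogonal (t : ℝ) (j k : ℕ) :
    ∫ x : ℝ, (P t j).eval x * (P t k).eval x * weight t x = if j = k then h t j else 0 := by
  change ip t (P t j) (P t k) = _
  split_ifs with hjk
  · subst hjk; rfl
  · rcases lt_or_gt_of_ne hjk with hlt | hgt
    · rw [ip_comm]; exact P_orthogonal_lt t k j hlt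
    · exact P_orthogonal_lt t j k hgt

/-- A polynomial of degree less than `n` is orthogonal to every sequence element of index at
least `n`, for any sequence of monic orthogonal polynomials. -/
lemma ip_eq_zero_of_degree_lt (t : ℝ) (Q : ℕ → ℝ[X]) (hm : ∀ n, (Q n).Monic)
    (hd : ∀ n, (Q n).degree = n) (ho : ∀ j k, j ≠ k → ip t (Q j) (Q k) = 0)
    (n : ℕ) : ∀ a : ℝ[X], a.degree < n → ∀ m, n ≤ m → ip t a (Q m) = 0 := by
  induction n with
  | zero =>
    intro a ha m _
    have : a = 0 := by
      rw [← degree_eq_bot]; exact Nat.WithBot.lt_zero_iff.1 (by exact_mod_cast ha)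
    rw [this, ← ipL_apply, map_zero]
  | succ n ih =>
    intro a ha m hm'
    have hsub : (a - C (a.coeff n) * Q n).degree < n := by
      rw [degree_lt_iff_coeff_zero]
      intro i hi
      have hQn : (Q n).natDegree = n := natDegree_eq_of_degree_eq_some (hd n)
      rcases eq_or_lt_of_le hi with rfl | hlt
      · have : (Q n).coeff n = 1 := by
          have := (hm n).coeff_natDegree
          rwa [hQn] at this
        simp [coeff_C_mul, this]
      · have h1 : a.coeff i = 0 := coeff_eq_zero_of_degree_lt
          (ha.trans_le (by exact_mod_cast hlt))
        have h2 : (Q n).coeff i = 0 := coeff_eq_zero_of_natDegree_lt (by omega)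
        simp [coeff_C_mul, h1, h2]
    have h0 := ih _ hsub m (by omega)
    rw [← ipL_apply, map_sub, ipL_apply, ipL_apply, ip_C_mul_left, ho n m (by omega)] at h0
    simpa using h0

/-- Uniqueness of the sequence of monic orthogonal polynomials. -/
lemma P_unique (t : ℝ) (Q : ℕ → ℝ[X]) (hm : ∀ n, (Q n).Monic)
    (hd : ∀ n, (Q n).degree = n) (ho : ∀ j k, j ≠ k → ip t (Q j) (Q k) = 0) : Q = P t := by
  funext n
  by_contra hne
  have hlt : (Q n - P t n).degree < n := by
    have := degree_sub_lt_left (p := Q n) (q := P t n) (by rw [hd, P_degree]) (hm n).ne_zero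
      (by rw [(hm n).leadingCoeff, (P_monic t n).leadingCoeff])
    rwa [hd] at this
  have h1 := ip_eq_zero_of_degree_lt t Q hm hd ho n _ hlt n le_rfl
  have h2 := ip_eq_zero_of_degree_lt t (P t) (P_monic t) (P_degree t)
    (fun j k hjk => by have := P_orthogonal t j k; rwa [if_neg hjk] at this) n _ hlt n le_rfl
  have h3 := ip_self_pos t (sub_ne_zero.2 hne)
  have h4 : ip t (Q n - P t n) (Q n - P t n)
      = ip t (Q n - P t n) (Q n) - ip t (Q n - P t n) (P t n) := by
    rw [ip_comm t _ (Q n), ip_comm t _ (P t n), ← ipL_apply, map_sub]; rfl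
  rw [h4, h1, h2] at h3
  simp at h3

lemma ip_comp_neg (t : ℝ) (a b : ℝ[X]) : ip t (a.comp (-X)) (b.comp (-X)) = ip t a b := by
  unfold ip
  rw [← integral_neg_eq_self]
  congr 1; ext x
  simp only [eval_comp, eval_neg, eval_X, neg_neg, weight]
  congr 2
  ring

/-- `P_n(-x) = (-1)^n P_n(x)`. -/
lemma P_parity (t : ℝ) (n : ℕ) : C ((-1) ^ n) * (P t n).comp (-X) = P t n := by
  have hnat (n : ℕ) : (P t n).natDegree = n := natDegree_eq_of_degree_eq_some (P_degree t n)
  have hmon : ∀ n, (C ((-1) ^ n) * (P t n).comp (-X)).Monic := by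
    intro n
    rw [Monic, leadingCoeff_mul, leadingCoeff_C, leadingCoeff_comp (by simp),
      (P_monic t n).leadingCoeff, hnat, leadingCoeff_neg, leadingCoeff_X, one_mul, ← mul_pow]
    simp
  refine congrFun (P_unique t (fun n => C ((-1) ^ n) * (P t n).comp (-X)) hmon ?_ ?_) n
  · intro n
    rw [degree_eq_natDegree (hmon n).ne_zero, natDegree_C_mul (by simp), natDegree_comp, hnat]
    simp
  · intro j k hjk
    have h0 := P_orthogonal t j k
    rw [if_neg hjk] at h0
    rw [ip_C_mul_left, ip_comm, ip_C_mul_left, ip_comp_neg, ip_comm]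
    change _ * (_ * ip t (P t j) (P t k)) = 0
    rw [show ip t (P t j) (P t k) = 0 from h0]
    simp

lemma eq_zero_of_ip_eq_zero (t : ℝ) (n : ℕ) (a : ℝ[X]) (ha : a.degree < n)
    (h0 : ∀ j < n, ip t a (P t j) = 0) : a = 0 := by
  by_contra hne
  have hdeg : a.degree = a.natDegree := degree_eq_natDegree hne
  have hlt : a.natDegree < n := by rw [hdeg] at ha; exact_mod_cast ha
  have hlc : a.leadingCoeff ≠ 0 := leadingCoeff_ne_zero.2 hne
  have h1 : (a - C a.leadingCoeff * P t a.natDegree).degree < a.natDegree := by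
    rw [← hdeg]
    refine degree_sub_lt_left ?_ hne ?_
    · rw [degree_C_mul hlc, P_degree, hdeg]
    · rw [leadingCoeff_mul, leadingCoeff_C, (P_monic t _).leadingCoeff, mul_one]
  have h2 := ip_eq_zero_of_degree_lt t (P t) (P_monic t) (P_degree t)
    (fun j k hjk => by have := P_orthogonal t j k; rwa [if_neg hjk] at this)
    _ _ h1 _ le_rfl
  rw [← ipL_apply, map_sub, ipL_apply, ipL_apply, ip_C_mul_left, h0 _ hlt, zero_sub, neg_eq_zero]
    at h2
  exact mul_ne_zero hlc (h_pos t a.natDegree).ne' h2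

/-- The recurrence `x P_n = P_{n+1} + β_n P_{n-1}` (where `β_0 P_{-1} = 0`). -/
lemma three_term_recurrence (t : ℝ) (n : ℕ) :
    X * P t n = P t (n + 1) + C (beta t n) * P t (n - 1) := by
  have ho : ∀ j k, j ≠ k → ip t (P t j) (P t k) = 0 :=
    fun j k hjk => by have := P_orthogonal t j k; rwa [if_neg hjk] at this
  have hdeg : (X * P t n).degree = ((n + 1 : ℕ) : WithBot ℕ) := by
    rw [degree_mul, degree_X, P_degree, add_comm]; rfl
  rw [← sub_eq_zero]
  apply eq_zero_of_ip_eq_zero t (n + 1)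
  · rw [← sub_sub]
    refine (degree_sub_le _ _).trans_lt (max_lt ?_ ?_)
    · have := degree_sub_lt_left (p := X * P t n) (q := P t (n + 1)) (by rw [hdeg, P_degree])
        (mul_ne_zero X_ne_zero (P_monic t n).ne_zero)
        (by rw [leadingCoeff_mul, leadingCoeff_X, (P_monic t n).leadingCoeff,
          (P_monic t _).leadingCoeff, one_mul])
      rwa [hdeg] at this
    · refine (degree_mul_le_of_le degree_C_le (P_degree t (n - 1)).le).trans_lt ?_
      rw [zero_add]
      exact_mod_cast (by omega : n - 1 < n + 1)
  · intro j hj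
    rw [← ipL_apply, map_sub, map_add]
    simp only [ipL_apply, ip_C_mul_left]
    rw [ho (n + 1) j (by omega)]
    rcases eq_or_lt_of_le (Nat.lt_succ_iff.1 hj) with rfl | hlt
    · have hx : ip t (X * P t j) (P t j) = 0 := by
        have h1 := ip_comp_neg t (X * P t j) (P t j)
        have h2 : (X * P t j).comp (-X) = C (-1) * (C ((-1) ^ j) * (X * P t j)) := by
          conv_rhs => rw [← P_parity t j]
          rw [show C (-1 : ℝ) * (C ((-1) ^ j) * (X * (C ((-1) ^ j) * (P t j).comp (-X))))
            = C ((-1) * ((-1) ^ j * (-1) ^ j)) * (X * (P t j).comp (-X)) by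
              simp only [C_mul]; ring, ← mul_pow]
          simp
        have h3 : (P t j).comp (-X) = C ((-1) ^ j) * P t j := by
          conv_rhs => rw [← P_parity t j]
          rw [← mul_assoc, ← C_mul, ← mul_pow]
          simp
        rw [h2, h3, ip_C_mul_left, ip_C_mul_left, ip_comm, ip_C_mul_left, ip_comm,
          ← mul_assoc ((-1 : ℝ) ^ j), ← mul_pow] at h1
        norm_num at h1
        linarith
      rw [hx]
      cases j with
      | zero => simp [beta]
      | succ i => rw [ho (i + 1 - 1) (i + 1) (by omega)]; simp
    · cases n with
      | zero => omega
      | succ i =>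
        rw [Nat.add_sub_cancel, ip_mul_left]
        rcases eq_or_lt_of_le (Nat.lt_succ_iff.1 hlt) with rfl | hji
        · have hne := (h_pos t j).ne'
          have hb : beta t (j + 1) = ip t (X * P t (j + 1)) (P t j) / h t j := rfl
          rw [hb, ip_mul_left]
          unfold h at hne ⊢
          field_simp
          ring
        · rw [ho i j (by omega), ip_comm,
            ip_eq_zero_of_degree_lt t (P t) (P_monic t) (P_degree t) ho (i + 1) (X * P t j) ?_
              _ le_rfl]
          · simp
          · rw [degree_mul, degree_X, P_degree, add_comm]
            exact_mod_cast (by omega : j + 1 < i + 1)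

end SexticFreud

end

/-! Write S for `stringForm`. Integrating the derivative of P_n P_{n-1} w over the line and
expanding x^5 P_n by the three-term recurrence gives the string equation 6 S(β_{n-2}, …, β_{n+2}) -
2tβ_n = n (`string_equation_succ`). The recurrence also gives p(n+1) = p(n) - β_n, and the closed
formula in (i) obeys the same relation because of two consecutive string equations, so (i) follows
by induction (`p_eq`).

For (ii), put m = (n/60)^{1/3} and r = 1/m. Since S(1,1,1,1,1) = 10, the rescaled coefficients
β_{n+j}/m satisfy S = 10 + O(r^2). Monotonicity of S and a comparison of limsup with liminf force
β_n/m → 1 (`tendsto_one_of_stringForm`, `tendsto_beta_div_cbrt`).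

The expansion is then justified by stability. The explicit `betaApprox` solves the rescaled string
equation up to O(r^10) (`stringForm_betaApprox_residual`). At (1,1,1,1,1) the gradient of S is (1,
6, 16, 6, 1), and 16 > 14, so the error at the middle of a window is bounded by a contracted maximum
over the window plus the residual (`abs_sub_le_of_stringForm`). A discrete maximum principle turns
this into β_n - `betaApprox` = O(n^{-3}) (`exists_le_div_pow_three`,
`exists_abs_beta_sub_betaApprox_le`). Inserting the expansion into (i) gives r^4 p(n,t) up to
O(r^10), hence p(n,t) up to O(r^6) = O(n^{-2}). -/

namespace SexticFreud

open Topology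

/-! ### String equation and closed formula for the subleading coefficient -/

/-- The cubic form of the string equation of the sextic Freud weight. -/
def stringForm (x₁ x₂ x₃ x₄ x₅ : ℝ) : ℝ :=
  x₃ * (x₁ * x₂ + x₂ ^ 2 + 2 * x₂ * x₃ + x₂ * x₄ + x₃ ^ 2 + 2 * x₃ * x₄ + x₄ ^ 2 + x₄ * x₅)

/-- The cubic form occurring in the formula for the subleading coefficient. -/
def coeffForm (x₁ x₂ x₃ x₄ x₅ : ℝ) : ℝ :=
  x₃ ^ 2 * (x₂ + x₃ + x₄) + (x₃ + x₄) * x₂ * (x₁ + x₂ + x₃) + (x₂ + x₃) * x₄ * (x₃ + x₄ + x₅)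

lemma ip_P_of_ne (t : ℝ) {j k : ℕ} (hjk : j ≠ k) : ip t (P t j) (P t k) = 0 := by
  have := P_orthogonal t j k
  rwa [if_neg hjk] at this

lemma ip_P_self (t : ℝ) (n : ℕ) : ip t (P t n) (P t n) = h t n := rfl

lemma ip_add_right (t : ℝ) (a b c : ℝ[X]) : ip t a (b + c) = ip t a b + ip t a c := by
  rw [ip_comm, ip_add_left, ip_comm t b, ip_comm t c]

lemma ip_C_mul_right (t r : ℝ) (a b : ℝ[X]) : ip t a (C r * b) = r * ip t a b := by
  rw [ip_comm, ip_C_mul_left, ip_comm]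

lemma ip_P_eq_zero_of_degree_lt (t : ℝ) {n : ℕ} {a : ℝ[X]} (ha : a.degree < n) :
    ip t a (P t n) = 0 :=
  ip_eq_zero_of_degree_lt t (P t) (P_monic t) (P_degree t) (fun _ _ => ip_P_of_ne t) n a ha n le_rfl

/-- Integration by parts against the weight. -/
lemma ip_derivative (t : ℝ) (a b : ℝ[X]) :
    ip t (derivative a) b + ip t a (derivative b)
      = ip t ((6 * X ^ 5 - C (2 * t) * X) * a) b := by
  have hd : ∀ x, HasDerivAt (fun x => (a * b).eval x * weight t x)
      ((derivative (a * b) - (6 * X ^ 5 - C (2 * t) * X) * (a * b)).eval x * weight t x) x := by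
    intro x
    have h1 : HasDerivAt (fun x : ℝ => -x ^ 6 + t * x ^ 2) (-(6 * x ^ 5) + t * (2 * x)) x := by
      have h6 := (hasDerivAt_pow 6 x).neg
      have h2 := (hasDerivAt_pow 2 x).const_mul t
      have := h6.add h2
      norm_num at this
      exact this
    have h2 := ((a * b).hasDerivAt x).mul h1.exp
    refine h2.congr_deriv ?_
    simp only [weight, eval_mul, eval_sub, eval_X, eval_pow, eval_C, eval_ofNat]
    ring
  have h0 := integral_eq_zero_of_hasDerivAt_of_integrable hd (integrable_weight t _)
    (integrable_weight t _)
  have h1 : ip t (derivative (a * b) - (6 * X ^ 5 - C (2 * t) * X) * (a * b)) 1 = 0 := by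
    rw [← h0]; simp [ip]
  have key : ∀ q c : ℝ[X], ip t (q * c) 1 = ip t q c := by
    intro q c; rw [mul_comm, ip_mul_left, mul_one, ip_comm, ip_comm]
  rw [← ipL_apply, map_sub, derivative_mul, map_add, ipL_apply, ipL_apply, ipL_apply, ← mul_assoc,
    key, key, key] at h1
  linarith

lemma beta_succ_mul_h (t : ℝ) (n : ℕ) : beta t (n + 1) * h t n = h t (n + 1) := by
  have hb : beta t (n + 1) = ip t (X * P t (n + 1)) (P t n) / h t n := rfl
  rw [hb, div_mul_cancel₀ _ (h_pos t n).ne', ip_mul_left, three_term_recurrence t n, ip_add_right,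
    ip_C_mul_right, ip_P_of_ne t (by omega : n + 1 ≠ n - 1), ip_P_self]
  ring

lemma beta_zero (t : ℝ) : beta t 0 = 0 := rfl

lemma beta_succ_pos (t : ℝ) (n : ℕ) : 0 < beta t (n + 1) :=
  pos_of_mul_pos_left ((beta_succ_mul_h t n).symm ▸ h_pos t (n + 1)) (h_pos t n).le

lemma beta_nonneg (t : ℝ) (n : ℕ) : 0 ≤ beta t n := by
  cases n with
  | zero => exact le_rfl
  | succ n => exact (beta_succ_pos t n).le

/-- Applies the recurrence twice. When `n - 2` truncates, the spurious last term is harmless because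
its coefficient contains `beta t 0 = 0`. -/
lemma X_sq_mul_P (t : ℝ) (n : ℕ) :
    X ^ 2 * P t n = P t (n + 2) + C (beta t (n + 1) + beta t n) * P t n
      + C (beta t n * beta t (n - 1)) * P t (n - 2) := by
  have h1 := three_term_recurrence t n
  have h2 := three_term_recurrence t (n + 1)
  have h3 := three_term_recurrence t (n - 1)
  cases n with
  | zero =>
    simp only [beta_zero, Nat.zero_sub, zero_add, C_0, zero_mul, add_zero, Nat.sub_self] at *
    rw [pow_two, mul_assoc, h1, h2]
  | succ n =>
    simp only [Nat.add_sub_cancel, show n + 1 - 2 = n - 1 by omega] at *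
    rw [pow_two, mul_assoc, h1, mul_add, h2, mul_left_comm, h3]
    simp only [C_add, C_mul]
    ring

lemma X_cube_mul_P (t : ℝ) (n : ℕ) :
    X ^ 3 * P t (n + 1) = P t (n + 4)
      + C (beta t (n + 3) + beta t (n + 2) + beta t (n + 1)) * P t (n + 2)
      + C (beta t (n + 1) * (beta t (n + 2) + beta t (n + 1) + beta t n)) * P t n
      + C (beta t (n + 1) * beta t n * beta t (n - 1)) * P t (n - 2) := by
  rw [pow_succ', mul_assoc, X_sq_mul_P, mul_add, mul_add, mul_left_comm, mul_left_comm X (C _),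
    three_term_recurrence t (n + 1 + 2), three_term_recurrence t (n + 1)]
  simp only [Nat.add_sub_cancel, show n + 1 - 2 = n - 1 by omega,
    show n + 1 + 2 - 1 = n + 2 by omega]
  rw [three_term_recurrence t (n - 1)]
  cases n with
  | zero => simp only [beta_zero, mul_zero, C_0, zero_mul, add_zero, zero_add, C_add, C_mul]; ring
  | succ n =>
    simp only [Nat.add_sub_cancel, show n + 1 - 2 = n - 1 by omega, C_add, C_mul]
    ring

lemma ip_X_mul_P (t : ℝ) (n : ℕ) : ip t (X * P t (n + 1)) (P t n) = h t (n + 1) := by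
  rw [← beta_succ_mul_h]
  exact (div_mul_cancel₀ _ (h_pos t n).ne').symm

/-- Splitting x^5 as x^3 · x^2 puts two short expansions against each other. Only the indices n + 2,
n and n - 2 occur in both, and the norms there are products of recurrence coefficients times h_n. -/
lemma ip_X_pow_five_mul_P (t : ℝ) (n : ℕ) :
    ip t (X ^ 5 * P t (n + 1)) (P t n)
      = stringForm (beta t (n - 1)) (beta t n) (beta t (n + 1)) (beta t (n + 2)) (beta t (n + 3))
        * h t n := by
  have h1 : ip t (X ^ 5 * P t (n + 1)) (P t n) = ip t (X ^ 3 * P t (n + 1)) (X ^ 2 * P t n) := by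
    rw [← ip_mul_left]; congr 1; ring
  rw [h1, X_cube_mul_P, X_sq_mul_P]
  simp only [ip_add_left, ip_add_right, ip_C_mul_left, ip_C_mul_right, ip_P_self]
  have e1 := beta_succ_mul_h t n
  have e2 := beta_succ_mul_h t (n + 1)
  rw [ip_P_of_ne t (by omega : n + 4 ≠ n + 2), ip_P_of_ne t (by omega : n + 4 ≠ n),
    ip_P_of_ne t (by omega : n + 4 ≠ n - 2), ip_P_of_ne t (by omega : n + 2 ≠ n),
    ip_P_of_ne t (by omega : n + 2 ≠ n - 2), ip_P_of_ne t (by omega : n ≠ n + 2),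
    ip_P_of_ne t (by omega : n - 2 ≠ n + 2), ← e2, ← e1]
  unfold stringForm
  -- For n = 0, 1 the index `n - 2` truncates to 0, but every affected term carries the factor `beta
  -- t 0 = 0`.
  match n with
  | 0 => simp only [beta_zero]; ring
  | 1 => simp only [beta_zero, Nat.sub_self]; ring
  | k + 2 =>
    have e3 := beta_succ_mul_h t k
    have e4 := beta_succ_mul_h t (k + 1)
    simp only [show k + 2 - 2 = k by omega, show k + 2 - 1 = k + 1 by omega] at *
    rw [ip_P_of_ne t (by omega : k + 2 ≠ k), ip_P_of_ne t (by omega : k ≠ k + 2), ← e4, ← e3]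
    ring

/-- The derivative of P_{n+1} is (n + 1) P_n plus terms of lower degree, which are orthogonal to
P_n. -/
lemma ip_derivative_P (t : ℝ) (n : ℕ) :
    ip t (derivative (P t (n + 1))) (P t n) = (n + 1) * h t n := by
  have hnat (n : ℕ) : (P t n).natDegree = n := natDegree_eq_of_degree_eq_some (P_degree t n)
  have hlt : (derivative (P t (n + 1)) - C ((n : ℝ) + 1) * P t n).degree < n := by
    rw [degree_lt_iff_coeff_zero]
    intro i hi
    rw [coeff_sub, coeff_derivative, coeff_C_mul]
    rcases eq_or_lt_of_le hi with rfl | hlt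
    · have h1 := (P_monic t n).coeff_natDegree
      have h2 := (P_monic t (n + 1)).coeff_natDegree
      rw [hnat] at h1 h2
      rw [h1, h2]; ring
    · rw [coeff_eq_zero_of_natDegree_lt (by rw [hnat]; omega),
        coeff_eq_zero_of_natDegree_lt (by rw [hnat]; omega)]
      ring
  have := ip_P_eq_zero_of_degree_lt t hlt
  rw [← ipL_apply, map_sub, ipL_apply, ipL_apply, ip_C_mul_left, ip_P_self] at this
  linarith

/-- The string equation (a discrete Painlevé equation) for the recurrence coefficients. -/
lemma string_equation_succ (t : ℝ) (n : ℕ) :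
    6 * stringForm (beta t (n - 1)) (beta t n) (beta t (n + 1)) (beta t (n + 2)) (beta t (n + 3))
      - 2 * t * beta t (n + 1) = n + 1 := by
  have h1 := ip_derivative t (P t (n + 1)) (P t n)
  have hz : ip t (P t (n + 1)) (derivative (P t n)) = 0 := by
    rw [ip_comm]
    refine ip_P_eq_zero_of_degree_lt t ?_
    refine (degree_derivative_le).trans_lt ?_
    rw [P_degree]
    exact_mod_cast n.lt_succ_self
  have h2 : (6 * X ^ 5 - C (2 * t) * X) * P t (n + 1)
      = C 6 * (X ^ 5 * P t (n + 1)) + C (-(2 * t)) * (X * P t (n + 1)) := by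
    rw [C_neg, show (C 6 : ℝ[X]) = 6 from rfl]; ring
  rw [hz, ip_derivative_P, h2, ip_add_left, ip_C_mul_left, ip_C_mul_left, ip_X_pow_five_mul_P,
    ip_X_mul_P, ← beta_succ_mul_h] at h1
  have h3 := (h_pos t n).ne'
  apply mul_right_cancel₀ h3
  linarith

lemma string_equation (t : ℝ) (n : ℕ) :
    6 * stringForm (beta t n) (beta t (n + 1)) (beta t (n + 2)) (beta t (n + 3)) (beta t (n + 4))
      - 2 * t * beta t (n + 2) = n + 2 := by
  have := string_equation_succ t (n + 1)
  simp only [Nat.add_sub_cancel, Nat.cast_add, Nat.cast_one] at this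
  rw [show (n : ℝ) + 2 = n + 1 + 1 by ring]
  exact this

/-- Compares the coefficients of x^{n-1} in the three-term recurrence. The first two cases match the
convention p(0,t) = p(1,t) = 0. -/
lemma p_succ (t : ℝ) (n : ℕ) : p (n + 1) t = p n t - beta t n := by
  have hnat (n : ℕ) : (P t n).natDegree = n := natDegree_eq_of_degree_eq_some (P_degree t n)
  match n with
  | 0 => simp [p, beta_zero]
  | 1 =>
    have h1 := congrArg (fun q => q.coeff 0) (three_term_recurrence t 1)
    have h2 := (P_monic t 0).coeff_natDegree
    rw [hnat] at h2
    simp [h2] at h1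
    simp [p]
    linarith
  | k + 2 =>
    have h1 := congrArg (fun q => q.coeff (k + 1)) (three_term_recurrence t (k + 2))
    have h2 := (P_monic t (k + 1)).coeff_natDegree
    rw [hnat] at h2
    simp [h2, coeff_X_mul] at h1
    simp [p]
    linarith

/-- The coefficient of `x ^ (n - 2)` in terms of the recurrence coefficients. -/
lemma p_eq (t : ℝ) (n : ℕ) :
    p n t = 1 / 2 * beta t n * (1 + 2 * t * beta t n
      - 6 * coeffForm (beta t (n - 2)) (beta t (n - 1)) (beta t n) (beta t (n + 1))
        (beta t (n + 2))) := by
  induction n with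
  | zero => simp [p, beta_zero]
  | succ n ih =>
    rw [p_succ, ih]
    have h1 := string_equation_succ t n
    unfold coeffForm
    unfold stringForm at h1
    match n with
    | 0 =>
      simp only [beta_zero, zero_add, Nat.cast_zero,
        show 1 - 2 = 0 from rfl] at *
      linear_combination (1 / 2 * beta t 1) * h1
    | k + 1 =>
      have h2 := string_equation_succ t k
      unfold stringForm at h2
      simp only [Nat.add_sub_cancel, show k + 1 - 2 = k - 1 by omega,
        show k + 1 + 1 - 2 = k by omega] at *
      push_cast at h1 h2
      -- The increment of the closed formula plus the lower of the two β's factors as half the sum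
      -- of the two β's times the defect of the difference of their string equations.
      linear_combination (1 / 2 * (beta t (k + 1) + beta t (k + 2))) * (h1 - h2)

/-! ### Leading order of the recurrence coefficients -/

lemma stringForm_le {x₁ x₂ x₃ x₄ x₅ y₁ y₂ y₃ y₄ y₅ : ℝ} (h₁ : 0 ≤ x₁) (h₂ : 0 ≤ x₂) (h₃ : 0 ≤ x₃)
    (h₄ : 0 ≤ x₄) (h₅ : 0 ≤ x₅) (k₁ : x₁ ≤ y₁) (k₂ : x₂ ≤ y₂) (k₃ : x₃ ≤ y₃) (k₄ : x₄ ≤ y₄)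
    (k₅ : x₅ ≤ y₅) : stringForm x₁ x₂ x₃ x₄ x₅ ≤ stringForm y₁ y₂ y₃ y₄ y₅ := by
  have := h₁.trans k₁
  have := h₂.trans k₂
  have := h₃.trans k₃
  have := h₄.trans k₄
  have := h₅.trans k₅
  unfold stringForm
  gcongr

lemma stringForm_smul (c x₁ x₂ x₃ x₄ x₅ : ℝ) :
    stringForm (c * x₁) (c * x₂) (c * x₃) (c * x₄) (c * x₅)
      = c ^ 3 * stringForm x₁ x₂ x₃ x₄ x₅ := by
  unfold stringForm; ring

/-- Freud's argument: a bounded nonnegative sequence that satisfies the limiting string equation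
asymptotically converges. -/
lemma tendsto_one_of_stringForm (u : ℕ → ℝ) (v : ℕ → ℕ → ℝ) (K : ℝ) (hu0 : ∀ n, 0 ≤ u n)
    (huK : ∀ n, u n ≤ K) (hv0 : ∀ j n, 0 ≤ v j n)
    (hv : ∀ j, Tendsto (fun n => v j n - u (n + j)) atTop (𝓝 0))
    (hS : Tendsto (fun n => stringForm (v 0 n) (v 1 n) (v 2 n) (v 3 n) (v 4 n)) atTop (𝓝 10)) :
    Tendsto u atTop (𝓝 1) := by
  have hba : IsBoundedUnder (· ≤ ·) atTop u := isBoundedUnder_of ⟨K, huK⟩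
  have hbb : IsBoundedUnder (· ≥ ·) atTop u := isBoundedUnder_of ⟨0, hu0⟩
  set B := limsup u atTop with hB
  set a := liminf u atTop with ha
  have haB : a ≤ B := liminf_le_limsup hba hbb
  have ha0 : 0 ≤ a := le_liminf_of_le hba.isCoboundedUnder_ge (Eventually.of_forall hu0)
  have hshift (j : ℕ) : Tendsto (fun n : ℕ => n + j) atTop atTop := tendsto_add_atTop_nat j
  have hupper (ε : ℝ) (hε : 0 < ε) (j : ℕ) : ∀ᶠ n in atTop, v j n ≤ B + ε := by
    have h1 := (hshift j).eventually
      (eventually_lt_of_limsup_lt (show limsup u atTop < B + ε / 2 by linarith) hba)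
    have h2 := (hv j).eventually_lt_const (half_pos hε)
    filter_upwards [h1, h2] with n h1 h2
    linarith
  have hlower (ε : ℝ) (hε : 0 < ε) (j : ℕ) : ∀ᶠ n in atTop, max (a - ε) 0 ≤ v j n := by
    have h1 := (hshift j).eventually
      (eventually_lt_of_lt_liminf (show a - ε / 2 < liminf u atTop by linarith) hbb)
    have h2 := (hv j).eventually_const_lt (show -(ε / 2) < 0 by linarith)
    filter_upwards [h1, h2] with n h1 h2
    exact max_le (by linarith) (hv0 j n)
  have hfreq {q : ℝ → Prop} (hq : ∃ᶠ n in atTop, q (u n)) : ∃ᶠ n in atTop, q (u (n + 2)) := by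
    rw [frequently_atTop] at hq ⊢
    intro N
    obtain ⟨b, hb, hqb⟩ := hq (N + 2)
    exact ⟨b - 2, by omega, by rwa [show b - 2 + 2 = b by omega]⟩
  -- At indices where the middle entry is close to the limsup, all neighbours are eventually at
  -- least about the liminf. The truncation at 0 keeps the arguments nonnegative, as monotonicity of
  -- the form requires; then ε tends to 0.
  have h1 : stringForm a a B a a ≤ 10 := by
    have hε : ∀ ε : ℝ, 0 < ε → stringForm (max (a - ε) 0) (max (a - ε) 0) (max (B - ε) 0)
        (max (a - ε) 0) (max (a - ε) 0) ≤ 10 + ε := by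
      intro ε hε
      have hf := hfreq (q := fun y => B - ε / 2 < y)
        (frequently_lt_of_lt_limsup hbb.isCoboundedUnder_le
          (show B - ε / 2 < limsup u atTop by linarith))
      have h2 := (hv 2).eventually_const_lt (show -(ε / 2) < 0 by linarith)
      obtain ⟨n, hn, h2, k0, k1, k3, k4, hs⟩ := (hf.and_eventually (h2.and
        ((hlower ε hε 0).and ((hlower ε hε 1).and ((hlower ε hε 3).and ((hlower ε hε 4).and
          (hS.eventually_lt_const (show 10 < 10 + ε by linarith)))))))).exists
      refine (stringForm_le ?_ ?_ ?_ ?_ ?_ k0 k1 (max_le ?_ (hv0 2 n)) k3 k4).trans hs.le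
      all_goals first | exact le_max_right _ _ | linarith
    have hc : Continuous fun ε : ℝ => stringForm (max (a - ε) 0) (max (a - ε) 0) (max (B - ε) 0)
        (max (a - ε) 0) (max (a - ε) 0) - ε := by
      unfold stringForm; fun_prop
    have := le_of_tendsto (hc.continuousWithinAt (s := Set.Ioi 0) (x := 0))
      (eventually_mem_nhdsWithin.mono fun ε hh => by
        have := hε ε hh; linarith : ∀ᶠ ε in 𝓝[>] (0 : ℝ), _ ≤ (10 : ℝ))
    simpa [ha0, ha0.trans haB] using this
  have h2 : 10 ≤ stringForm B B a B B := by
    have hε : ∀ ε : ℝ, 0 < ε → 10 - ε ≤ stringForm (B + ε) (B + ε) (a + ε) (B + ε) (B + ε) := by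
      intro ε hε
      have hf := hfreq (q := fun y => y < a + ε / 2)
        (frequently_lt_of_liminf_lt hba.isCoboundedUnder_ge
          (show liminf u atTop < a + ε / 2 by linarith))
      have h2 := (hv 2).eventually_lt_const (half_pos hε)
      obtain ⟨n, hn, h2, k0, k1, k3, k4, hs⟩ := (hf.and_eventually (h2.and
        ((hupper ε hε 0).and ((hupper ε hε 1).and ((hupper ε hε 3).and ((hupper ε hε 4).and
          (hS.eventually_const_lt (show 10 - ε < 10 by linarith)))))))).exists
      refine hs.le.trans (stringForm_le ?_ ?_ ?_ ?_ ?_ k0 k1 ?_ k3 k4)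
      all_goals first | exact hv0 _ n | linarith
    have hc : Continuous fun ε : ℝ =>
        stringForm (B + ε) (B + ε) (a + ε) (B + ε) (B + ε) + ε := by
      unfold stringForm; fun_prop
    have := ge_of_tendsto (hc.continuousWithinAt (s := Set.Ioi 0) (x := 0))
      (eventually_mem_nhdsWithin.mono fun ε hh => by
        have := hε ε hh; linarith : ∀ᶠ ε in 𝓝[>] (0 : ℝ), (10 : ℝ) ≤ _)
    simpa using this
  unfold stringForm at h1 h2
  have heq : a = B := by
    by_contra hne
    have hlt : 0 < B - a := sub_pos.2 (lt_of_le_of_ne haB hne)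
    -- S(a,a,B,a,a) - S(B,B,a,B,B) = (B - a)(B² + a²), while `h1` and `h2` make the left side
    -- nonpositive.
    have : 0 < (B - a) * (B ^ 2 + a ^ 2) := by
      have : 0 < B := by linarith
      positivity
    nlinarith
  have ha1 : a = 1 := by
    rw [← heq] at h1 h2
    have h3 : a ^ 3 = 1 ^ 3 := by linarith
    exact (pow_left_inj₀ ha0 zero_le_one three_ne_zero).1 h3
  exact tendsto_of_liminf_eq_limsup ha1 (hB ▸ heq ▸ ha1) hba hbb

/-- The leading order `(n / 60) ^ (1 / 3)` of the recurrence coefficients. -/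
noncomputable def cbrt (n : ℕ) : ℝ := ((n : ℝ) / 60) ^ (1 / 3 : ℝ)

lemma cbrt_nonneg (n : ℕ) : 0 ≤ cbrt n := by unfold cbrt; positivity

lemma cbrt_pos {n : ℕ} (hn : 0 < n) : 0 < cbrt n := by unfold cbrt; positivity

lemma cbrt_pow_three (n : ℕ) : cbrt n ^ 3 = n / 60 := by
  unfold cbrt
  rw [← Real.rpow_natCast, ← Real.rpow_mul (by positivity)]
  norm_num

lemma tendsto_cbrt : Tendsto cbrt atTop atTop :=
  (tendsto_rpow_atTop (by norm_num)).comp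
    (tendsto_natCast_atTop_atTop.atTop_div_const (by norm_num))

lemma tendsto_inv_cbrt : Tendsto (fun n => (cbrt n)⁻¹) atTop (𝓝 0) :=
  tendsto_cbrt.inv_tendsto_atTop

lemma tendsto_natCast_add_div (j k : ℕ) :
    Tendsto (fun n : ℕ => ((n + j : ℕ) : ℝ) / ((n + k : ℕ) : ℝ)) atTop (𝓝 1) := by
  have h1 : Tendsto (fun n : ℕ => 1 + ((j : ℝ) - k) / ((n + k : ℕ) : ℝ)) atTop (𝓝 (1 + 0)) :=
    tendsto_const_nhds.add (Tendsto.div_atTop tendsto_const_nhds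
      (tendsto_natCast_atTop_atTop.comp (tendsto_add_atTop_nat k)))
  rw [add_zero] at h1
  refine h1.congr' ?_
  filter_upwards [eventually_gt_atTop 0] with n hn
  have : (0 : ℝ) < n := by exact_mod_cast hn
  push_cast
  field_simp
  ring

lemma tendsto_cbrt_add_div (j k : ℕ) :
    Tendsto (fun n : ℕ => cbrt (n + j) / cbrt (n + k)) atTop (𝓝 1) := by
  have h1 := (tendsto_natCast_add_div j k).rpow_const (p := 1 / 3) (Or.inl one_ne_zero)
  rw [Real.one_rpow] at h1
  refine h1.congr fun n => ?_
  unfold cbrt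
  rw [← Real.div_rpow (by positivity) (by positivity)]
  congr 1
  rcases Nat.eq_zero_or_pos (n + k) with h0 | h0
  · simp [h0]
  · have : (0 : ℝ) < ((n + k : ℕ) : ℝ) := by exact_mod_cast h0
    field_simp

/-- All β's are nonnegative, so the string equation with only the cube of the middle term kept gives
6β_n³ ≤ n + 2tβ_n. This a priori bound makes the limsup argument available. -/
lemma beta_div_cbrt_le (t : ℝ) (n : ℕ) : beta t n / cbrt n ≤ 10 + 6 * |t| := by
  cases n with
  | zero => rw [beta_zero, zero_div]; positivity
  | succ n =>
    have hm := cbrt_pos n.succ_pos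
    have hm3 := cbrt_pow_three (n + 1)
    set m := cbrt (n + 1)
    have hb := beta_succ_pos t n
    set u := beta t (n + 1) / m with hu
    have hu0 : 0 < u := div_pos hb hm
    have hbu : beta t (n + 1) = u * m := by rw [hu]; field_simp
    have h1 : (n + 1 : ℝ) = 60 * m ^ 3 := by rw [hm3]; push_cast; ring
    -- Here m³ ≥ 1/60 ≥ 1/64. This lets the linear term be absorbed through m ≤ 16 m³.
    have h2 : 1 / 4 ≤ m := by
      refine le_of_pow_le_pow_left₀ three_ne_zero hm.le ?_
      rw [hm3, div_pow, div_le_div_iff₀ (by norm_num) (by norm_num)]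
      push_cast
      have := n.cast_nonneg (α := ℝ)
      linarith
    have h3 : m ≤ 16 * m ^ 3 := by nlinarith [mul_nonneg hm.le (sub_nonneg.2 h2)]
    have h4 := string_equation_succ t n
    have h5 : stringForm 0 0 (beta t (n + 1)) 0 0 ≤ stringForm (beta t (n - 1)) (beta t n)
        (beta t (n + 1)) (beta t (n + 2)) (beta t (n + 3)) :=
      stringForm_le le_rfl le_rfl hb.le le_rfl le_rfl (beta_nonneg t _) (beta_nonneg t _) le_rfl
        (beta_nonneg t _) (beta_nonneg t _)
    have h6 : 6 * u ^ 3 ≤ 60 + 32 * |t| * u := by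
      have h7 : 6 * (u * m) ^ 3 - 2 * t * (u * m) ≤ 60 * m ^ 3 := by
        rw [← h1, ← h4, hbu]
        rw [hbu] at h5
        simp only [stringForm] at h5 ⊢
        linarith
      have h8 : t * (u * m) ≤ |t| * (u * (16 * m ^ 3)) := by
        refine (mul_le_mul_of_nonneg_right (le_abs_self t) (by positivity)).trans ?_
        gcongr
      have h9 : m ^ 3 * (6 * u ^ 3) ≤ m ^ 3 * (60 + 32 * |t| * u) := by nlinarith
      exact le_of_mul_le_mul_left h9 (by positivity)
    by_contra! hlt
    have ht := abs_nonneg t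
    have h10 : 1 < u := by linarith
    have h11 : u ^ 2 < u ^ 3 := pow_lt_pow_right₀ h10 (by norm_num)
    have h12 : (10 + 6 * |t|) * u < u * u := mul_lt_mul_of_pos_right hlt hu0
    nlinarith [mul_nonneg ht hu0.le]

/-- Homogeneity of degree 3 turns the string equation into a perturbation of S = 10 that vanishes as
m grows. All five entries are scaled by the cube root at the middle index n + 2. -/
lemma stringForm_beta_div (t : ℝ) (n : ℕ) {m : ℝ} (hm : m = cbrt (n + 2)) :
    stringForm (beta t n / m) (beta t (n + 1) / m) (beta t (n + 2) / m) (beta t (n + 3) / m)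
      (beta t (n + 4) / m) = 10 + t / 3 * m⁻¹ ^ 2 * (beta t (n + 2) / m) := by
  have hp : 0 < m := hm ▸ cbrt_pos (by omega)
  have h1 : (n + 2 : ℝ) = 60 * m ^ 3 := by rw [hm, cbrt_pow_three]; push_cast; ring
  have h2 := string_equation t n
  simp only [div_eq_inv_mul]
  rw [stringForm_smul]
  field_simp
  linarith

/-- Freud's conjecture for the sextic weight. -/
lemma tendsto_beta_div_cbrt (t : ℝ) : Tendsto (fun n => beta t n / cbrt n) atTop (𝓝 1) := by
  have hbd (n : ℕ) : |beta t n / cbrt n| ≤ 10 + 6 * |t| := by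
    rw [abs_of_nonneg (div_nonneg (beta_nonneg t n) (cbrt_nonneg n))]
    exact beta_div_cbrt_le t n
  refine tendsto_one_of_stringForm _ (fun j n => beta t (n + j) / cbrt (n + 2)) (10 + 6 * |t|)
    (fun n => div_nonneg (beta_nonneg t n) (cbrt_nonneg n)) (beta_div_cbrt_le t)
    (fun j n => div_nonneg (beta_nonneg t _) (cbrt_nonneg _)) (fun j => ?_) ?_
  · have h1 : Tendsto (fun n => (10 + 6 * |t|) * |cbrt (n + j) / cbrt (n + 2) - 1|) atTop
        (𝓝 ((10 + 6 * |t|) * |1 - 1|)) :=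
      ((tendsto_cbrt_add_div j 2).sub_const 1).abs.const_mul _
    rw [sub_self, abs_zero, mul_zero] at h1
    refine squeeze_zero_norm (fun n => ?_) h1
    have h2 : beta t (n + j) / cbrt (n + 2) - beta t (n + j) / cbrt (n + j)
        = beta t (n + j) / cbrt (n + j) * (cbrt (n + j) / cbrt (n + 2) - 1) := by
      rcases Nat.eq_zero_or_pos (n + j) with h0 | h0
      · simp [h0, beta_zero]
      · have := cbrt_pos h0
        field_simp
    rw [h2, norm_mul]
    exact mul_le_mul_of_nonneg_right (hbd _) (abs_nonneg _)
  · simp only [add_zero, stringForm_beta_div t _ rfl]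
    have h1 : Tendsto (fun n => |t / 3| * (cbrt (n + 2))⁻¹ ^ 2 * (10 + 6 * |t|)) atTop
        (𝓝 (|t / 3| * 0 ^ 2 * (10 + 6 * |t|))) :=
      (((tendsto_inv_cbrt.comp (tendsto_add_atTop_nat 2)).pow 2).const_mul _).mul_const _
    have h2 : Tendsto (fun n => t / 3 * (cbrt (n + 2))⁻¹ ^ 2 * (beta t (n + 2) / cbrt (n + 2)))
        atTop (𝓝 0) := by
      rw [show |t / 3| * 0 ^ 2 * (10 + 6 * |t|) = 0 by ring] at h1
      refine squeeze_zero_norm (fun n => ?_) h1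
      rw [norm_mul, norm_mul, norm_pow, Real.norm_eq_abs, Real.norm_eq_abs, Real.norm_eq_abs,
        abs_of_nonneg (inv_nonneg.2 (cbrt_nonneg _))]
      have := cbrt_nonneg (n + 2)
      gcongr
      exact hbd _
    simpa using h2.const_add 10

/-! ### Stability of the string equation -/

/-- Near (1,1,1) the product xyz has all partial derivatives close to 1. Telescoping leaves three
increments, each multiplied by some ab - 1 of size at most 3ε. -/
lemma abs_mul_sub_mul_sub_le {x₁ x₂ x₃ y₁ y₂ y₃ ε G : ℝ} (hε : ε ≤ 1)
    (hx₁ : |x₁ - 1| ≤ ε) (hx₂ : |x₂ - 1| ≤ ε) (hy₂ : |y₂ - 1| ≤ ε)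
    (hy₃ : |y₃ - 1| ≤ ε) (h₁ : |y₁ - x₁| ≤ G) (h₂ : |y₂ - x₂| ≤ G) (h₃ : |y₃ - x₃| ≤ G) :
    |y₁ * y₂ * y₃ - x₁ * x₂ * x₃ - ((y₁ - x₁) + (y₂ - x₂) + (y₃ - x₃))| ≤ 9 * ε * G := by
  have hε0 : 0 ≤ ε := (abs_nonneg _).trans hx₁
  have key : ∀ {a b e : ℝ}, |a - 1| ≤ ε → |b - 1| ≤ ε → |e| ≤ G →
      |e * (a * b - 1)| ≤ 3 * ε * G := by
    intro a b e ha hb he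
    have h : |a * b - 1| ≤ 3 * ε := by
      rw [show a * b - 1 = (a - 1) * (b - 1) + ((a - 1) + (b - 1)) by ring]
      refine (abs_add_le _ _).trans ?_
      have h1 : |(a - 1) * (b - 1)| ≤ ε * 1 := by
        rw [abs_mul]; exact mul_le_mul ha (hb.trans hε) (abs_nonneg _) hε0
      have h2 := abs_add_le (a - 1) (b - 1)
      linarith
    rw [abs_mul, mul_comm]
    exact mul_le_mul h he (abs_nonneg _) (by positivity)
  have k1 := key hy₂ hy₃ h₁
  have k2 := key hx₁ hy₃ h₂
  have k3 := key hx₁ hx₂ h₃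
  rw [show y₁ * y₂ * y₃ - x₁ * x₂ * x₃ - ((y₁ - x₁) + (y₂ - x₂) + (y₃ - x₃))
    = (y₁ - x₁) * (y₂ * y₃ - 1) + (y₂ - x₂) * (x₁ * y₃ - 1) + (y₃ - x₃) * (x₁ * x₂ - 1) by ring]
  refine (abs_add_le _ _).trans ?_
  have := abs_add_le ((y₁ - x₁) * (y₂ * y₃ - 1)) ((y₂ - x₂) * (x₁ * y₃ - 1))
  linarith

/-- The linearisation of the string equation at a constant solution is diagonally dominant. -/
lemma abs_sub_le_of_stringForm (x y : ℕ → ℝ) {G : ℝ} (hx : ∀ j < 5, |x j - 1| ≤ 1 / 180)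
    (hy : ∀ j < 5, |y j - 1| ≤ 1 / 180) (hG : ∀ j < 5, |y j - x j| ≤ G) :
    |y 2 - x 2| ≤ 29 / 32 * G + 1 / 16 *
      |stringForm (y 0) (y 1) (y 2) (y 3) (y 4) - stringForm (x 0) (x 1) (x 2) (x 3) (x 4)| := by
  have hG0 : 0 ≤ G := (abs_nonneg _).trans (hG 0 (by norm_num))
  have mon : ∀ i < 5, ∀ j < 5, ∀ k < 5, |y i * y j * y k - x i * x j * x k
      - ((y i - x i) + (y j - x j) + (y k - x k))| ≤ 9 * (1 / 180) * G :=
    fun i hi j hj k hk => abs_mul_sub_mul_sub_le (by norm_num) (hx i hi) (hx j hj) (hy j hj)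
      (hy k hk) (hG i hi) (hG j hj) (hG k hk)
  have m1 := abs_le.1 (mon 2 (by norm_num) 0 (by norm_num) 1 (by norm_num))
  have m2 := abs_le.1 (mon 2 (by norm_num) 1 (by norm_num) 1 (by norm_num))
  have m3 := abs_le.1 (mon 2 (by norm_num) 1 (by norm_num) 2 (by norm_num))
  have m4 := abs_le.1 (mon 2 (by norm_num) 1 (by norm_num) 3 (by norm_num))
  have m5 := abs_le.1 (mon 2 (by norm_num) 2 (by norm_num) 2 (by norm_num))
  have m6 := abs_le.1 (mon 2 (by norm_num) 2 (by norm_num) 3 (by norm_num))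
  have m7 := abs_le.1 (mon 2 (by norm_num) 3 (by norm_num) 3 (by norm_num))
  have m8 := abs_le.1 (mon 2 (by norm_num) 3 (by norm_num) 4 (by norm_num))
  have g0 := abs_le.1 (hG 0 (by norm_num))
  have g1 := abs_le.1 (hG 1 (by norm_num))
  have g3 := abs_le.1 (hG 3 (by norm_num))
  have g4 := abs_le.1 (hG 4 (by norm_num))
  set D := stringForm (y 0) (y 1) (y 2) (y 3) (y 4) - stringForm (x 0) (x 1) (x 2) (x 3) (x 4)
    with hD
  have hDe : D = (y 2 * y 0 * y 1 - x 2 * x 0 * x 1) + (y 2 * y 1 * y 1 - x 2 * x 1 * x 1)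
      + 2 * (y 2 * y 1 * y 2 - x 2 * x 1 * x 2) + (y 2 * y 1 * y 3 - x 2 * x 1 * x 3)
      + (y 2 * y 2 * y 2 - x 2 * x 2 * x 2) + 2 * (y 2 * y 2 * y 3 - x 2 * x 2 * x 3)
      + (y 2 * y 3 * y 3 - x 2 * x 3 * x 3) + (y 2 * y 3 * y 4 - x 2 * x 3 * x 4) := by
    rw [hD]; unfold stringForm; ring
  have d1 := le_abs_self D
  have d2 := neg_abs_le D
  rw [abs_le]
  -- The middle increment has weight 16 and the neighbours have total weight 14. The ten monomials,
  -- counted with multiplicity, contribute an error of at most 10 · 9/180 · G = G/2. Dividing by 16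
  -- gives 14/16 + 1/32 = 29/32.
  constructor <;> linarith [m1.1, m1.2, m2.1, m2.2, m3.1, m3.2, m4.1, m4.2, m5.1, m5.2, m6.1, m6.2,
    m7.1, m7.2, m8.1, m8.2, g0.1, g0.2, g1.1, g1.2, g3.1, g3.2, g4.1, g4.2]

/-- A discrete maximum principle: a sequence of sublinear growth which is dominated by a contracted
maximum over neighbouring terms, up to an error `O(n⁻³)`, is itself `O(n⁻³)`. -/
lemma exists_le_div_pow_three (f : ℕ → ℝ) (C : ℝ) (hf : ∀ ε > 0, ∀ᶠ n : ℕ in atTop, f n ≤ ε * n)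
    (h : ∀ᶠ n : ℕ in atTop, ∀ G : ℝ, (∀ j < 5, f (n + j) ≤ G) →
      f (n + 2) ≤ 15 / 16 * G + C / ((n : ℝ) + 2) ^ 3) :
    ∃ M : ℝ, ∀ n : ℕ, 0 < n → f n ≤ M / (n : ℝ) ^ 3 := by
  obtain ⟨N₀, hN₀⟩ := eventually_atTop.1 h
  set N := max N₀ 200 with hN
  obtain ⟨M, hMC, hM0, hMf⟩ : ∃ M : ℝ, 32 * C ≤ M ∧ 0 ≤ M ∧
      ∀ k ∈ Finset.range (N + 2), f k * (k : ℝ) ^ 3 ≤ M := by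
    obtain ⟨M₁, hM₁⟩ := ((Finset.range (N + 2)).image fun k => f k * (k : ℝ) ^ 3).bddAbove
    refine ⟨max M₁ (max (32 * C) 0), by simp, by simp, fun k hk => le_max_of_le_left (hM₁ ?_)⟩
    exact Finset.mem_coe.2 (Finset.mem_image_of_mem _ hk)
  refine ⟨M, ?_⟩
  -- The barrier M/n³ is enlarged by εn, which eventually dominates f. A positive excess therefore
  -- has a maximum over all positive indices, attained in a finite range.
  have main : ∀ ε > 0, ∀ n : ℕ, 0 < n → f n ≤ M / (n : ℝ) ^ 3 + ε * n := by
    intro ε hε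
    by_contra! hbad
    obtain ⟨k₀, hk₀, hfk₀⟩ := hbad
    obtain ⟨N₁, hN₁⟩ := eventually_atTop.1 (hf ε hε)
    obtain ⟨k, hk, hmax⟩ := Finset.exists_max_image (Finset.Icc 1 (max k₀ N₁))
      (fun n : ℕ => f n - (M / (n : ℝ) ^ 3 + ε * n)) ⟨k₀, by simp; omega⟩
    set d := f k - (M / (k : ℝ) ^ 3 + ε * k) with hd
    have hd0 : 0 < d := by
      have := hmax k₀ (by simp; omega)
      linarith
    have hall : ∀ n : ℕ, 0 < n → f n ≤ M / (n : ℝ) ^ 3 + ε * n + d := by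
      intro n hn
      by_cases hnk : n ≤ max k₀ N₁
      · have := hmax n (by rw [Finset.mem_Icc]; omega)
        linarith
      · have h1 := hN₁ n (by omega)
        have : 0 ≤ M / (n : ℝ) ^ 3 := by positivity
        linarith
    have hk1 : 1 ≤ k := (Finset.mem_Icc.1 hk).1
    have hkN : N + 2 ≤ k := by
      by_contra! hlt
      have h1 := hMf k (Finset.mem_range.2 hlt)
      have hk0 : (0 : ℝ) < k := by exact_mod_cast hk1
      rw [← le_div_iff₀ (by positivity)] at h1
      have : 0 ≤ ε * k := by positivity
      linarith
    obtain ⟨n, rfl⟩ : ∃ n, k = n + 2 := ⟨k - 2, by omega⟩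
    have hn200 : (200 : ℝ) ≤ n := by exact_mod_cast (by omega : 200 ≤ n)
    have hn0 : (0 : ℝ) < n := by linarith
    have h2 := hN₀ n (by omega) (M / (n : ℝ) ^ 3 + ε * (n + 4) + d) (by
      intro j hj
      refine (hall (n + j) (by omega)).trans ?_
      have hj4 : (j : ℝ) ≤ 4 := by exact_mod_cast (by omega : j ≤ 4)
      push_cast
      have : (n : ℝ) ≤ n + j := by linarith [j.cast_nonneg (α := ℝ)]
      gcongr)
    push_cast at hd
    have h3 : 15 / 16 * (ε * (n + 4)) ≤ ε * (n + 2) := by nlinarith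
    -- Passing from n to n + 2 in the barrier costs a factor ((n+2)/n)³ ≤ 1.01³ for n ≥ 200, so
    -- 15/16 becomes at most 31/32. The spare 1/32 of M absorbs C because 32 C ≤ M.
    have h4 : 15 / 16 * (M / (n : ℝ) ^ 3) + C / ((n : ℝ) + 2) ^ 3 ≤ M / ((n : ℝ) + 2) ^ 3 := by
      have h5 : 15 / 16 * (M / (n : ℝ) ^ 3) ≤ 31 / 32 * M / ((n : ℝ) + 2) ^ 3 := by
        rw [← mul_div_assoc, div_le_div_iff₀ (by positivity) (by positivity)]
        have h6 : ((n : ℝ) + 2) ^ 3 ≤ (101 / 100 * n) ^ 3 := by gcongr; linarith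
        have h7 : 15 / 16 * ((n : ℝ) + 2) ^ 3 ≤ 31 / 32 * (n : ℝ) ^ 3 := by
          have : (0 : ℝ) ≤ (n : ℝ) ^ 3 := by positivity
          nlinarith
        nlinarith
      have h8 : C / ((n : ℝ) + 2) ^ 3 ≤ 1 / 32 * M / ((n : ℝ) + 2) ^ 3 := by gcongr; linarith
      have h9 : 31 / 32 * M / ((n : ℝ) + 2) ^ 3 + 1 / 32 * M / ((n : ℝ) + 2) ^ 3
          = M / ((n : ℝ) + 2) ^ 3 := by ring
      linarith
    linarith
  intro n hn
  have hc : Continuous fun ε : ℝ => M / (n : ℝ) ^ 3 + ε * n := by fun_prop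
  have := ge_of_tendsto (hc.continuousWithinAt (s := Set.Ioi 0) (x := 0))
    (eventually_mem_nhdsWithin.mono fun ε hε => main ε hε n hn)
  simpa using this

/-! ### Tools for asymptotic expansions -/

lemma isBigO_of_eq_mul {f g k : ℕ → ℝ} {c : ℝ} (hk : Tendsto k atTop (𝓝 c))
    (hf : ∀ᶠ n in atTop, f n = g n * k n) : f =O[atTop] g := by
  have h1 : (fun n => g n * k n) =O[atTop] fun n => g n * 1 :=
    (isBigO_refl g atTop).mul (hk.isBigO_one ℝ)
  simp only [mul_one] at h1
  exact h1.congr' (hf.mono fun _ h => h.symm) EventuallyEq.rfl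

lemma isBigO_pow_of_eq_mul {f r : ℕ → ℝ} {F : ℝ → ℝ} {k : ℕ} (hr : Tendsto r atTop (𝓝 0))
    (hF : Continuous F) (hf : ∀ᶠ n in atTop, f n = r n ^ k * F (r n)) :
    f =O[atTop] fun n => r n ^ k :=
  isBigO_of_eq_mul ((hF.tendsto 0).comp hr) hf

/-- A C¹ map is strictly differentiable at the common limit c, hence Lipschitz near c. -/
lemma isBigO_comp_sub_comp {ι : Type*} [Fintype ι] {Φ : (ι → ℝ) → ℝ} (hΦ : ContDiff ℝ 1 Φ)
    {x y : ℕ → ι → ℝ} {c : ι → ℝ} {g : ℕ → ℝ} (hx : Tendsto x atTop (𝓝 c))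
    (hy : Tendsto y atTop (𝓝 c)) (h : ∀ i, (fun n => y n i - x n i) =O[atTop] g) :
    (fun n => Φ (y n) - Φ (x n)) =O[atTop] g := by
  have h1 := (hΦ.contDiffAt (x := c)).hasStrictFDerivAt one_ne_zero
  have h2 := h1.isBigO_sub.comp_tendsto (hy.prodMk_nhds hx)
  exact h2.trans (isBigO_pi.2 h)

/-- The Taylor expansions of powers of a cube root near `1`. -/
lemma cube_root_expansions {w z : ℕ → ℝ} (hz : Tendsto z atTop (𝓝 0))
    (hw : Tendsto w atTop (𝓝 1)) (hwz : ∀ n, w n ^ 3 = 1 + z n) :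
    ((fun n => w n - (1 + z n / 3 - z n ^ 2 / 9 + 5 * z n ^ 3 / 81)) =O[atTop] fun n => z n ^ 4) ∧
    ((fun n => (w n)⁻¹ - (1 - z n / 3 + 2 * z n ^ 2 / 9)) =O[atTop] fun n => z n ^ 3) ∧
    ((fun n => (w n)⁻¹ ^ 5 - (1 - 5 * z n / 3)) =O[atTop] fun n => z n ^ 2) ∧
    ((fun n => (w n)⁻¹ ^ 7 - 1) =O[atTop] z) := by
  have hpos : ∀ᶠ n in atTop, 0 < w n := hw.eventually_const_lt one_pos
  have hz1 : ∀ᶠ n in atTop, 0 < 1 + z n :=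
    (hz.eventually_const_lt (show (-1 : ℝ) < 0 by norm_num)).mono fun n hn => by linarith
  obtain ⟨k, hk, hwk⟩ : ∃ k : ℕ → ℝ, Tendsto k atTop (𝓝 (-10 / 243)) ∧
      ∀ᶠ n in atTop, w n = 1 + z n / 3 - z n ^ 2 / 9 + 5 * z n ^ 3 / 81 + z n ^ 4 * k n := by
    -- With q the cubic Taylor polynomial, w - q = (w³ - q³)/(w² + wq + q²), and w³ - q³ = 1 + z -
    -- q³ is divisible by z⁴. F is the quotient after removing z⁴.
    let F : ℝ × ℝ → ℝ := fun a =>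
      (-10 / 81 + 2 / 243 * a.1 + 8 / 2187 * a.1 ^ 2 - 40 / 6561 * a.1 ^ 3 + 25 / 19683 * a.1 ^ 4
        - 125 / 531441 * a.1 ^ 5) / (a.2 ^ 2
          + a.2 * (1 + a.1 / 3 - a.1 ^ 2 / 9 + 5 * a.1 ^ 3 / 81)
          + (1 + a.1 / 3 - a.1 ^ 2 / 9 + 5 * a.1 ^ 3 / 81) ^ 2)
    have hF : ContinuousAt F (0, 1) := by
      refine ContinuousAt.div (by fun_prop) (by fun_prop) (by norm_num)
    have hF0 : F (0, 1) = -10 / 243 := by norm_num [F]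
    refine ⟨fun n => F (z n, w n), hF0 ▸ hF.tendsto.comp (hz.prodMk_nhds hw), ?_⟩
    filter_upwards [hpos] with n hn
    have h3 := hwz n
    simp only [F]
    generalize z n = z at *
    generalize w n = w at *
    have hd : 0 < w ^ 2 + w * (1 + z / 3 - z ^ 2 / 9 + 5 * z ^ 3 / 81)
        + (1 + z / 3 - z ^ 2 / 9 + 5 * z ^ 3 / 81) ^ 2 := by
      generalize 1 + z / 3 - z ^ 2 / 9 + 5 * z ^ 3 / 81 = q
      nlinarith [sq_nonneg (q + w / 2), pow_pos hn 2]
    rw [← sub_eq_iff_eq_add', ← mul_div_assoc, eq_div_iff hd.ne']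
    linear_combination h3
  have hzk := hz.prodMk_nhds hk
  -- Since w³ = 1 + z, negative powers of w become w or w² over a power of 1 + z, so the expansion
  -- of w itself suffices for all of them.
  have hinv : ∀ᶠ n in atTop, (w n)⁻¹ = w n ^ 2 / (1 + z n) := by
    filter_upwards [hpos, hz1] with n h1 h2
    have := hwz n
    rw [inv_eq_one_div, div_eq_div_iff h1.ne' h2.ne']
    linarith
  refine ⟨isBigO_of_eq_mul hk ?_, ?_, ?_, ?_⟩
  · filter_upwards [hwk] with n h
    linarith
  · let F : ℝ × ℝ → ℝ := fun a =>
      (2 * (5 / 81 + a.1 * a.2) - 8 / 27 + a.1 * (1 / 81 + 2 * (5 / 81 + a.1 * a.2) / 3)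
        - 2 * a.1 ^ 2 * (5 / 81 + a.1 * a.2) / 9 + a.1 ^ 3 * (5 / 81 + a.1 * a.2) ^ 2) / (1 + a.1)
    have hF : ContinuousAt F (0, -10 / 243) :=
      ContinuousAt.div (by fun_prop) (by fun_prop) (by norm_num)
    refine isBigO_of_eq_mul (hF.tendsto.comp hzk) ?_
    filter_upwards [hwk, hz1, hinv] with n h1 h2 h3
    rw [h3, h1]
    simp only [F, Function.comp_apply]
    field_simp
    ring
  · let F : ℝ × ℝ → ℝ := fun a =>
      (-1 / 9 + a.1 * (5 / 81 + a.1 * a.2) + 7 / 3 + 5 * a.1 / 3) / (1 + a.1) ^ 2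
    have hF : ContinuousAt F (0, -10 / 243) :=
      ContinuousAt.div (by fun_prop) (by fun_prop) (by norm_num)
    refine isBigO_of_eq_mul (hF.tendsto.comp hzk) ?_
    filter_upwards [hwk, hz1, hpos] with n h1 h2 h3
    have h4 : (w n)⁻¹ ^ 5 = w n / (1 + z n) ^ 2 := by
      rw [← hwz n]; field_simp
    rw [h4, h1]
    simp only [F, Function.comp_apply]
    field_simp
    ring
  · let F : ℝ × ℝ → ℝ := fun a =>
      (2 * (1 / 3 - a.1 / 9 + a.1 ^ 2 * (5 / 81 + a.1 * a.2))
        + a.1 * (1 / 3 - a.1 / 9 + a.1 ^ 2 * (5 / 81 + a.1 * a.2)) ^ 2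
        - 3 - 3 * a.1 - a.1 ^ 2) / (1 + a.1) ^ 3
    have hF : ContinuousAt F (0, -10 / 243) :=
      ContinuousAt.div (by fun_prop) (by fun_prop) (by norm_num)
    refine isBigO_of_eq_mul (hF.tendsto.comp hzk) ?_
    filter_upwards [hwk, hz1, hpos] with n h1 h2 h3
    have h4 : (w n)⁻¹ ^ 7 = w n ^ 2 / (1 + z n) ^ 3 := by
      rw [← hwz n]; field_simp
    rw [h4, h1]
    simp only [F, Function.comp_apply]
    field_simp
    ring

/-! ### The truncated expansion and its algebra -/

/-- The coefficient of `(60 / n) ^ (1 / 3)` in the asymptotic expansion of `β_n`. -/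
noncomputable def coeffOne (t : ℝ) : ℝ := t / 90

/-- The coefficient of `(60 / n) ^ (5 / 3)` in the asymptotic expansion of `β_n`. -/
noncomputable def coeffFive (t : ℝ) : ℝ := 1 / 64800 - t ^ 3 / 2187000

/-- The coefficient of `(60 / n) ^ (7 / 3)` in the asymptotic expansion of `β_n`. -/
noncomputable def coeffSeven (t : ℝ) : ℝ := -t / 8748000 + t ^ 4 / 196830000

/-- The truncated asymptotic expansion of `β_n`. -/
noncomputable def betaApprox (t : ℝ) (n : ℕ) : ℝ :=
  cbrt n + coeffOne t * (cbrt n)⁻¹ + coeffFive t * (cbrt n)⁻¹ ^ 5 + coeffSeven t * (cbrt n)⁻¹ ^ 7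

/-- With `r = (60 / n) ^ (1 / 3)`, the Taylor expansion in the shift `k` of `r * β_{n + k}`. -/
noncomputable def shiftTaylor (t k r : ℝ) : ℝ :=
  1 + coeffOne t * r ^ 2 + coeffFive t * r ^ 6 + coeffSeven t * r ^ 8
    + k * (r ^ 3 * (1 - coeffOne t * r ^ 2 - 5 * coeffFive t * r ^ 6) / 180)
    - k ^ 2 * (r ^ 6 * (1 - 2 * coeffOne t * r ^ 2) / 32400)
    + k ^ 3 * (5 * r ^ 9 / 17496000)

lemma continuous_shiftTaylor (t k : ℝ) : Continuous (shiftTaylor t k) := by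
  unfold shiftTaylor; fun_prop

lemma shiftTaylor_zero (t k : ℝ) : shiftTaylor t k 0 = 1 := by simp [shiftTaylor]

lemma tendsto_inv_cbrt_add (k : ℕ) : Tendsto (fun n => (cbrt (n + k))⁻¹) atTop (𝓝 0) :=
  tendsto_inv_cbrt.comp (tendsto_add_atTop_nat k)

lemma tendsto_shiftTaylor (t k : ℝ) :
    Tendsto (fun n => shiftTaylor t k (cbrt (n + 2))⁻¹) atTop (𝓝 1) :=
  shiftTaylor_zero t k ▸ ((continuous_shiftTaylor t k).tendsto 0).comp (tendsto_inv_cbrt_add 2)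

lemma inv_cbrt_pow_three (n : ℕ) : (cbrt n)⁻¹ ^ 3 = 60 / n := by
  rw [inv_pow, cbrt_pow_three, inv_div]

/-- With κ = j - 2, the ratio w of the cube roots at n + j and n + 2 satisfies w³ = 1 + κr³/60.
Expanding each power of w just far enough leaves O(r^10). -/
lemma betaApprox_sub_shiftTaylor (t : ℝ) (j : ℕ) :
    (fun n => betaApprox t (n + j) / cbrt (n + 2) - shiftTaylor t ((j : ℝ) - 2) (cbrt (n + 2))⁻¹)
      =O[atTop] fun n => (cbrt (n + 2))⁻¹ ^ 10 := by
  set r : ℕ → ℝ := fun n => (cbrt (n + 2))⁻¹ with hr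
  set κ : ℝ := (j : ℝ) - 2 with hκ
  have hr0 : Tendsto r atTop (𝓝 0) := tendsto_inv_cbrt_add 2
  set z : ℕ → ℝ := fun n => κ / 60 * r n ^ 3 with hz
  set w : ℕ → ℝ := fun n => cbrt (n + j) / cbrt (n + 2) with hw
  have hz0 : Tendsto z atTop (𝓝 0) := by
    have := (hr0.pow 3).const_mul (κ / 60)
    simpa using this
  have hwz (n : ℕ) : w n ^ 3 = 1 + z n := by
    simp only [hw, hz, hr, div_pow, cbrt_pow_three, inv_cbrt_pow_three, hκ]
    push_cast
    field_simp
    ring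
  obtain ⟨h1, h2, h3, h4⟩ := cube_root_expansions hz0 (tendsto_cbrt_add_div j 2) hwz
  have hzr (i : ℕ) : (fun n => z n ^ i) =O[atTop] fun n => r n ^ (3 * i) :=
    isBigO_of_eq_mul (tendsto_const_nhds (x := (κ / 60) ^ i))
      (Eventually.of_forall fun n => by simp only [hz]; rw [mul_pow, ← pow_mul, mul_comm])
  have hrr {i l : ℕ} (hil : i ≤ l) : (fun n => r n ^ l) =O[atTop] fun n => r n ^ i :=
    isBigO_pow_of_eq_mul (F := fun r => r ^ (l - i)) hr0 (by fun_prop)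
      (Eventually.of_forall fun n => by rw [← pow_add]; congr 1; omega)
  have e1 : (fun n => w n - (1 + z n / 3 - z n ^ 2 / 9 + 5 * z n ^ 3 / 81))
      =O[atTop] fun n => r n ^ 10 := (h1.trans (hzr 4)).trans (hrr (by norm_num))
  have emul {f : ℕ → ℝ} {i l : ℕ} (c : ℝ) (hf : f =O[atTop] fun n => r n ^ i) (hil : 10 ≤ l + i) :
      (fun n => c * (r n ^ l * f n)) =O[atTop] fun n => r n ^ 10 := by
    refine (((isBigO_refl (fun n => r n ^ l) atTop).mul hf).const_mul_left c).trans ?_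
    simp only [← pow_add]
    exact hrr hil
  have e2 := emul (l := 2) (coeffOne t) (h2.trans (hzr 3)) (by norm_num)
  have e3 := emul (l := 6) (coeffFive t) (h3.trans (hzr 2)) (by norm_num)
  have e4 := emul (l := 8) (i := 3) (coeffSeven t) (h4.trans (by simpa using hzr 1)) (by norm_num)
  refine (((e1.add e2).add e3).add e4).congr' ?_ EventuallyEq.rfl
  filter_upwards [eventually_gt_atTop 0] with n hn
  have p1 : cbrt (n + j) ≠ 0 := (cbrt_pos (by omega)).ne'
  have p2 : cbrt (n + 2) ≠ 0 := (cbrt_pos (by omega)).ne'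
  have hb : betaApprox t (n + j) / cbrt (n + 2) = w n + coeffOne t * (r n ^ 2 * (w n)⁻¹)
      + coeffFive t * (r n ^ 6 * (w n)⁻¹ ^ 5) + coeffSeven t * (r n ^ 8 * (w n)⁻¹ ^ 7) := by
    simp only [betaApprox, hw, hr]
    field_simp
  rw [hb]
  simp only [shiftTaylor, hz]
  ring

/-- Reversing the window leaves the form unchanged, so terms odd in (α, η) cancel. In the
application α, γ, η have orders r³, r⁶, r⁹, and the last bracket is O(r^12). -/
lemma stringForm_quadratic_shift (B α γ η : ℝ) :
    stringForm (B - 2 * α + 4 * γ - 8 * η) (B - α + γ - η) B (B + α + γ + η)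
      (B + 2 * α + 4 * γ + 8 * η)
      = 10 * B ^ 3 + 20 * B ^ 2 * γ + 5 * B * α ^ 2
        + B * (11 * γ ^ 2 + 22 * α * η + 17 * η ^ 2) := by
  unfold stringForm; ring

lemma coeffForm_quadratic_shift (B α γ η : ℝ) :
    coeffForm (B - 2 * α + 4 * γ - 8 * η) (B - α + γ - η) B (B + α + γ + η)
      (B + 2 * α + 4 * γ + 8 * η)
      = 15 * B ^ 3 + 40 * B ^ 2 * γ + B * (36 * γ ^ 2 + 12 * α * η + 12 * η ^ 2)
        + 10 * γ * (γ ^ 2 - η ^ 2 - α ^ 2 - 2 * α * η) := by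
  unfold coeffForm; ring

lemma shiftTaylor_values (t r : ℝ) : ∃ B α γ η : ℝ,
    B = 1 + coeffOne t * r ^ 2 + r ^ 6 * (coeffFive t + coeffSeven t * r ^ 2) ∧
    α = r ^ 3 * ((1 - coeffOne t * r ^ 2 - 5 * coeffFive t * r ^ 6) / 180) ∧
    γ = r ^ 6 * (-(1 - 2 * coeffOne t * r ^ 2) / 32400) ∧ η = r ^ 9 * (5 / 17496000) ∧
    shiftTaylor t (-2) r = B - 2 * α + 4 * γ - 8 * η ∧ shiftTaylor t (-1) r = B - α + γ - η ∧
    shiftTaylor t 0 r = B ∧ shiftTaylor t 1 r = B + α + γ + η ∧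
    shiftTaylor t 2 r = B + 2 * α + 4 * γ + 8 * η := by
  refine ⟨_, _, _, _, rfl, rfl, rfl, rfl, ?_, ?_, ?_, ?_, ?_⟩ <;> · unfold shiftTaylor; ring

/-- With a = `coeffOne t`, this is exactly the vanishing of the r⁶ coefficient in the string
equation; `coeffSeven_eq` plays the same role at r⁸. -/
lemma coeffFive_eq (t : ℝ) : coeffFive t = 1 / 64800 - coeffOne t ^ 3 / 3 := by
  unfold coeffFive coeffOne; ring

lemma coeffSeven_eq (t : ℝ) : coeffSeven t = -coeffOne t / 97200 + coeffOne t ^ 4 / 3 := by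
  unfold coeffSeven coeffOne; ring

/-- The truncated expansion satisfies the string equation up to a small residual. -/
lemma exists_stringForm_shiftTaylor (t : ℝ) : ∃ F : ℝ → ℝ, Continuous F ∧ ∀ r,
    stringForm (shiftTaylor t (-2) r) (shiftTaylor t (-1) r) (shiftTaylor t 0 r)
      (shiftTaylor t 1 r) (shiftTaylor t 2 r) - t / 3 * r ^ 2 * shiftTaylor t 0 r - 10
      = r ^ 10 * F r := by
  have h5 := coeffFive_eq t
  have h7 := coeffSeven_eq t
  have ht : t = 90 * coeffOne t := by unfold coeffOne; ring
  -- The witness is the residual divided by r^10. Orders r² and r⁴ cancel through t = 90a, orders r⁶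
  -- and r⁸ through the relations for the two higher coefficients.
  refine ⟨fun r =>
    let a := coeffOne t
    let e := coeffFive t
    let g := coeffSeven t
    let b := e + g * r ^ 2
    let A := 1 + a * r ^ 2
    let B := A + r ^ 6 * b
    let α := (1 - a * r ^ 2 - 5 * e * r ^ 6) / 180
    let γ := -(1 - 2 * a * r ^ 2) / 32400
    let d := a ^ 2 - 10 * e * r ^ 2 * (1 - a * r ^ 2) + 25 * e ^ 2 * r ^ 8
    30 * (a * g + a ^ 2 * b) + 30 * A * r ^ 2 * b ^ 2 + 10 * r ^ 8 * b ^ 3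
      - ((a ^ 2 + 2 * r ^ 2 * A * b + r ^ 8 * b ^ 2) * (1 - 2 * a * r ^ 2) - 4 * a ^ 2) / 1620
      + (d * A - 2 * a ^ 2 + r ^ 2 * b * (1 - 2 * a * r ^ 2) + r ^ 6 * b * d) / 6480
      + r ^ 2 * B * (11 * γ ^ 2 + 22 * α * (5 / 17496000) + 17 * r ^ 6 * (5 / 17496000) ^ 2),
    by fun_prop, fun r => ?_⟩
  obtain ⟨B, α, γ, η, hB, hα, hγ, hη, e1, e2, e3, e4, e5⟩ := shiftTaylor_values t r
  rw [e1, e2, e3, e4, e5, stringForm_quadratic_shift, hα, hγ, hη, hB]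
  clear e1 e2 e3 e4 e5 hB hα hγ hη
  generalize coeffOne t = a at *
  generalize coeffFive t = e at *
  generalize coeffSeven t = g at *
  subst ht
  linear_combination (30 * r ^ 6 + 30 * a * r ^ 8) * h5 + 30 * r ^ 8 * h7

/-- The expansion of the subleading coefficient, multiplied by `r ^ 4`, `r = (60 / n) ^ (1 / 3)`. -/
noncomputable def scaledExpansion (t r : ℝ) : ℝ :=
  -45 - t * r ^ 2 + r ^ 3 / 2 - t ^ 2 * r ^ 4 / 90 + t * r ^ 5 / 180
    - (2 * t ^ 3 - 45) * r ^ 6 / 48600 + t ^ 4 * r ^ 8 / 4374000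
    - (4 * t ^ 3 - 135) * r ^ 9 / 17496000

/-- Writing β = u/r in the closed formula and multiplying by r⁴ turns its terms 1 and 2tβ into r³
and 2t r² u. The expansion of β through r⁸ therefore fixes every order below r^10. -/
lemma exists_coeffForm_shiftTaylor (t : ℝ) : ∃ F : ℝ → ℝ, Continuous F ∧ ∀ r,
    1 / 2 * shiftTaylor t 0 r * (r ^ 3 + 2 * t * r ^ 2 * shiftTaylor t 0 r
      - 6 * coeffForm (shiftTaylor t (-2) r) (shiftTaylor t (-1) r) (shiftTaylor t 0 r)
      (shiftTaylor t 1 r) (shiftTaylor t 2 r)) - scaledExpansion t r = r ^ 10 * F r := by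
  have h5 := coeffFive_eq t
  have h7 := coeffSeven_eq t
  have ht : t = 90 * coeffOne t := by unfold coeffOne; ring
  refine ⟨fun r =>
    let a := coeffOne t
    let e := coeffFive t
    let g := coeffSeven t
    let b := e + g * r ^ 2
    let A := 1 + a * r ^ 2
    let B := A + r ^ 6 * b
    let α := (1 - a * r ^ 2 - 5 * e * r ^ 6) / 180
    let γ := -(1 - 2 * a * r ^ 2) / 32400
    let η := 5 / 17496000
    r * g / 2 + 90 * a * (2 * g + 2 * a * b) + 90 * a * r ^ 4 * b ^ 2
      - 180 * (3 * a * g + (3 * a ^ 2 + a ^ 3 * r ^ 2) * b)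
      - 45 * r ^ 2 * (6 * A ^ 2 * b ^ 2 + 4 * A * r ^ 6 * b ^ 3 + r ^ 12 * b ^ 4)
      + (3 * a ^ 2 + a ^ 3 * r ^ 2 - 2 * a * (3 * a + 3 * a ^ 2 * r ^ 2 + a ^ 3 * r ^ 4)) / 270
      + (1 - 2 * a * r ^ 2)
        * (3 * A ^ 2 * r ^ 2 * b + 3 * A * r ^ 8 * b ^ 2 + r ^ 14 * b ^ 3) / 270
      - 3 * r ^ 2 * B * (B * (36 * γ ^ 2 + 12 * α * η + 12 * r ^ 6 * η ^ 2)
        + 10 * γ * (r ^ 6 * γ ^ 2 - r ^ 12 * η ^ 2 - α ^ 2 - 2 * r ^ 6 * α * η)),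
    by fun_prop, fun r => ?_⟩
  obtain ⟨B, α, γ, η, hB, hα, hγ, hη, e1, e2, e3, e4, e5⟩ := shiftTaylor_values t r
  rw [e1, e2, e3, e4, e5, coeffForm_quadratic_shift, hα, hγ, hη, hB]
  clear e1 e2 e3 e4 e5 hB hα hγ hη
  unfold scaledExpansion
  generalize coeffOne t = a at *
  generalize coeffFive t = e at *
  generalize coeffSeven t = g at *
  subst ht
  linear_combination (-180 * r ^ 6 - 360 * a * r ^ 8 + r ^ 9 / 2) * h5 - 180 * r ^ 8 * h7

/-! ### Comparison of β_n with its expansion -/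

/-- The sixth slot carries r itself; it is the same on both sides and contributes nothing to the
difference. -/
lemma isBigO_comp_vec_sub {Φ : (Fin 6 → ℝ) → ℝ} (hΦ : ContDiff ℝ 1 Φ) {x y : ℕ → ℕ → ℝ}
    {r g : ℕ → ℝ} (hr : Tendsto r atTop (𝓝 0)) (hx : ∀ j, Tendsto (x j) atTop (𝓝 1))
    (hy : ∀ j, Tendsto (y j) atTop (𝓝 1)) (h : ∀ j, (fun n => y j n - x j n) =O[atTop] g) :
    (fun n => Φ ![y 0 n, y 1 n, y 2 n, y 3 n, y 4 n, r n]
      - Φ ![x 0 n, x 1 n, x 2 n, x 3 n, x 4 n, r n]) =O[atTop] g := by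
  have hc {y : ℕ → ℕ → ℝ} (hy : ∀ j, Tendsto (y j) atTop (𝓝 1)) :
      Tendsto (fun n => ![y 0 n, y 1 n, y 2 n, y 3 n, y 4 n, r n]) atTop
        (𝓝 ![1, 1, 1, 1, 1, 0]) := by
    rw [tendsto_pi_nhds]
    simp only [Fin.forall_fin_succ]
    exact ⟨hy 0, hy 1, hy 2, hy 3, hy 4, hr, fun i => i.elim0⟩
  refine isBigO_comp_sub_comp hΦ (hc hx) (hc hy) ?_
  simp only [Fin.forall_fin_succ]
  refine ⟨h 0, h 1, h 2, h 3, h 4, ?_, fun i => i.elim0⟩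
  simpa using isBigO_zero g atTop

lemma tendsto_betaApprox_div (t : ℝ) (j : ℕ) :
    Tendsto (fun n => betaApprox t (n + j) / cbrt (n + 2)) atTop (𝓝 1) := by
  have h1 := (betaApprox_sub_shiftTaylor t j).trans_tendsto
    (by simpa using (tendsto_inv_cbrt_add 2).pow 10)
  simpa using h1.add (tendsto_shiftTaylor t ((j : ℝ) - 2))

lemma tendsto_beta_div (t : ℝ) (j : ℕ) :
    Tendsto (fun n => beta t (n + j) / cbrt (n + 2)) atTop (𝓝 1) := by
  have h1 := ((tendsto_beta_div_cbrt t).comp (tendsto_add_atTop_nat j)).mul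
    (tendsto_cbrt_add_div j 2)
  rw [mul_one] at h1
  refine h1.congr' ?_
  filter_upwards [eventually_gt_atTop 0] with n hn
  have := cbrt_pos (show 0 < n + j by omega)
  simp only [Function.comp_apply]
  field_simp

lemma stringForm_betaApprox_residual (t : ℝ) :
    (fun n => stringForm (betaApprox t n / cbrt (n + 2)) (betaApprox t (n + 1) / cbrt (n + 2))
      (betaApprox t (n + 2) / cbrt (n + 2)) (betaApprox t (n + 3) / cbrt (n + 2))
      (betaApprox t (n + 4) / cbrt (n + 2))
      - t / 3 * (cbrt (n + 2))⁻¹ ^ 2 * (betaApprox t (n + 2) / cbrt (n + 2)) - 10)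
      =O[atTop] fun n => (cbrt (n + 2))⁻¹ ^ 10 := by
  have hr := tendsto_inv_cbrt_add 2
  have hΦ : ContDiff ℝ 1 fun v : Fin 6 → ℝ =>
      stringForm (v 0) (v 1) (v 2) (v 3) (v 4) - t / 3 * v 5 ^ 2 * v 2 := by
    unfold stringForm; fun_prop
  have h1 := isBigO_comp_vec_sub hΦ hr
    (x := fun j n => shiftTaylor t ((j : ℝ) - 2) (cbrt (n + 2))⁻¹)
    (y := fun j n => betaApprox t (n + j) / cbrt (n + 2))
    (fun j => tendsto_shiftTaylor t _) (tendsto_betaApprox_div t) (betaApprox_sub_shiftTaylor t)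
  obtain ⟨F, hF, hFr⟩ := exists_stringForm_shiftTaylor t
  have h2 := isBigO_pow_of_eq_mul hr hF (Eventually.of_forall fun n => hFr (cbrt (n + 2))⁻¹)
  refine (h1.add h2).congr_left fun n => ?_
  simp only [Matrix.cons_val]
  norm_num

/-- The recurrence coefficients agree with the truncated expansion up to `O(n⁻³)`. -/
lemma exists_abs_beta_sub_betaApprox_le (t : ℝ) :
    ∃ M : ℝ, ∀ n : ℕ, 0 < n → |beta t n - betaApprox t n| ≤ M / (n : ℝ) ^ 3 := by
  obtain ⟨C, hC⟩ := (stringForm_betaApprox_residual t).bound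
  refine exists_le_div_pow_three _ (C / 16 * 60 ^ 3) (fun ε hε => ?_) ?_
  · have h1 := ((tendsto_beta_div t 2).sub (tendsto_betaApprox_div t 2)).abs
    rw [sub_self, abs_zero] at h1
    obtain ⟨N, hN⟩ := eventually_atTop.1 (h1.eventually_lt_const hε)
    filter_upwards [eventually_ge_atTop (N + 2)] with n hn
    obtain ⟨k, rfl⟩ : ∃ k, n = k + 2 := ⟨n - 2, by omega⟩
    have h2 := hN k (by omega)
    have hm := cbrt_pos (show 0 < k + 2 by omega)
    rw [← sub_div, abs_div, abs_of_pos hm, div_lt_iff₀ hm] at h2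
    refine h2.le.trans (mul_le_mul_of_nonneg_left ?_ hε.le)
    refine le_of_pow_le_pow_left₀ three_ne_zero (Nat.cast_nonneg _) ?_
    rw [cbrt_pow_three]
    have h3 : (1 : ℝ) ≤ ((k + 2 : ℕ) : ℝ) := by exact_mod_cast (by omega : 1 ≤ k + 2)
    have h4 := pow_le_pow_right₀ h3 (show 1 ≤ 3 by norm_num)
    rw [pow_one] at h4
    linarith
  · have near {f : ℕ → ℝ} (hf : ∀ j, Tendsto (fun n => f (n + j) / cbrt (n + 2)) atTop (𝓝 1)) :
        ∀ᶠ n in atTop, ∀ j < 5, |f (n + j) / cbrt (n + 2) - 1| ≤ 1 / 180 := by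
      have h1 (j : ℕ) : ∀ᶠ n in atTop, |f (n + j) / cbrt (n + 2) - 1| ≤ 1 / 180 := by
        have := ((hf j).sub_const 1).abs
        rw [sub_self, abs_zero] at this
        exact this.eventually_le_const (by norm_num)
      have h2 := (Finset.range 5).eventually_all.2 fun j _ => h1 j
      simpa using h2
    -- The t-term of the rescaled equation then contributes at most 1/16 · 1/2 = 1/32, raising the
    -- contraction constant from 29/32 to 15/16.
    have hsmall : ∀ᶠ n in atTop, |t| / 3 * (cbrt (n + 2))⁻¹ ^ 2 ≤ 1 / 2 := by
      have := ((tendsto_inv_cbrt_add 2).pow 2).const_mul (|t| / 3)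
      norm_num at this
      exact (this.eventually_le_const (show (0 : ℝ) < 1 / 2 by norm_num)).mono fun n hn => by
        simpa using hn
    filter_upwards [hC, near (tendsto_beta_div t), near (tendsto_betaApprox_div t), hsmall]
      with n hCn hy hx hs G hG
    have hm := cbrt_pos (show 0 < n + 2 by omega)
    have hr3 := inv_cbrt_pow_three (n + 2)
    have hst := stringForm_beta_div t n rfl
    have hlin := abs_sub_le_of_stringForm (fun j => betaApprox t (n + j) / cbrt (n + 2))
      (fun j => beta t (n + j) / cbrt (n + 2)) (G := G / cbrt (n + 2)) hx hy (fun j hj => by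
        rw [← sub_div, abs_div, abs_of_pos hm]
        exact div_le_div_of_nonneg_right (hG j hj) hm.le)
    simp only [add_zero] at hlin
    rw [hst] at hlin
    rw [Real.norm_eq_abs,
      Real.norm_of_nonneg (show 0 ≤ (cbrt (n + 2))⁻¹ ^ 10 by positivity)] at hCn
    set m := cbrt (n + 2) with hmdef
    set Sx := stringForm (betaApprox t n / m) (betaApprox t (n + 1) / m)
      (betaApprox t (n + 2) / m) (betaApprox t (n + 3) / m) (betaApprox t (n + 4) / m)
    have hG0 : 0 ≤ G := (abs_nonneg _).trans (hG 0 (by norm_num))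
    have h2 : |beta t (n + 2) / m - betaApprox t (n + 2) / m| ≤ G / m := by
      rw [← sub_div, abs_div, abs_of_pos hm]
      exact div_le_div_of_nonneg_right (hG 2 (by norm_num)) hm.le
    have h3 : |10 + t / 3 * m⁻¹ ^ 2 * (beta t (n + 2) / m) - Sx|
        ≤ 1 / 2 * (G / m) + C * m⁻¹ ^ 10 := by
      rw [show 10 + t / 3 * m⁻¹ ^ 2 * (beta t (n + 2) / m) - Sx
        = t / 3 * m⁻¹ ^ 2 * (beta t (n + 2) / m - betaApprox t (n + 2) / m)
          - (Sx - t / 3 * m⁻¹ ^ 2 * (betaApprox t (n + 2) / m) - 10) by ring]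
      refine (abs_sub _ _).trans (add_le_add ?_ hCn)
      rw [abs_mul, abs_mul, abs_div, abs_of_nonneg (show (0 : ℝ) ≤ m⁻¹ ^ 2 by positivity),
        abs_of_pos (show (0 : ℝ) < 3 by norm_num)]
      exact mul_le_mul hs h2 (abs_nonneg _) (by norm_num)
    have h4 : |beta t (n + 2) / m - betaApprox t (n + 2) / m|
        ≤ (15 / 16 * G + C / 16 * (m⁻¹ ^ 3) ^ 3) / m := by
      refine (hlin.trans (add_le_add_right
        (mul_le_mul_of_nonneg_left h3 (by norm_num)) _)).trans (le_of_eq ?_)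
      field_simp
      ring
    rw [← sub_div, abs_div, abs_of_pos hm, div_le_div_iff_of_pos_right hm, hr3] at h4
    refine h4.trans (le_of_eq ?_)
    rw [div_pow]
    push_cast
    ring

lemma beta_sub_shiftTaylor (t : ℝ) (j : ℕ) :
    (fun n => beta t (n + j) / cbrt (n + 2) - shiftTaylor t ((j : ℝ) - 2) (cbrt (n + 2))⁻¹)
      =O[atTop] fun n => (cbrt (n + 2))⁻¹ ^ 10 := by
  obtain ⟨M, hM⟩ := exists_abs_beta_sub_betaApprox_le t
  have hM0 : 0 ≤ M := by
    have := (abs_nonneg _).trans (hM 1 one_pos)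
    simpa using this
  have h1 : (fun n => beta t (n + j) / cbrt (n + 2) - betaApprox t (n + j) / cbrt (n + 2))
      =O[atTop] fun n => (cbrt (n + 2))⁻¹ ^ 10 := by
    refine IsBigO.of_bound (M * 27 / 60 ^ 3) ?_
    filter_upwards [eventually_ge_atTop 1] with n hn
    have hm := cbrt_pos (show 0 < n + 2 by omega)
    have hn1 : (1 : ℝ) ≤ n := by exact_mod_cast hn
    have h2 := hM (n + j) (by omega)
    -- For n ≥ 1 one has n + j ≥ (n + 2)/3, which produces the factor 27; the rest is r³ = 60/(n +
    -- 2).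
    have h3 : M / ((n + j : ℕ) : ℝ) ^ 3 ≤ M * 27 / 60 ^ 3 * (cbrt (n + 2))⁻¹ ^ 9 := by
      rw [show (cbrt (n + 2))⁻¹ ^ 9 = ((cbrt (n + 2))⁻¹ ^ 3) ^ 3 by ring, inv_cbrt_pow_three,
        show M * 27 / 60 ^ 3 * (60 / ((n + 2 : ℕ) : ℝ)) ^ 3 = M / (((n + 2 : ℕ) : ℝ) / 3) ^ 3 by
          field_simp; norm_num]
      push_cast
      have : (0 : ℝ) ≤ j := j.cast_nonneg
      gcongr
      linarith
    rw [← sub_div, norm_div, Real.norm_eq_abs, Real.norm_of_nonneg hm.le,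
      Real.norm_of_nonneg (by positivity), div_eq_mul_inv]
    calc _ ≤ M * 27 / 60 ^ 3 * (cbrt (n + 2))⁻¹ ^ 9 * (cbrt (n + 2))⁻¹ :=
          mul_le_mul_of_nonneg_right (h2.trans h3) (by positivity)
      _ = _ := by ring
  exact (h1.add (betaApprox_sub_shiftTaylor t j)).congr_left fun n => by ring

/-! ### Expansion of the subleading coefficient -/

lemma scaled_p_sub_scaledExpansion (t : ℝ) :
    (fun n => p (n + 2) t * (cbrt (n + 2))⁻¹ ^ 4 - scaledExpansion t (cbrt (n + 2))⁻¹)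
      =O[atTop] fun n => (cbrt (n + 2))⁻¹ ^ 10 := by
  have hr := tendsto_inv_cbrt_add 2
  have hΦ : ContDiff ℝ 1 fun v : Fin 6 → ℝ => 1 / 2 * v 2 * (v 5 ^ 3 + 2 * t * v 5 ^ 2 * v 2
      - 6 * coeffForm (v 0) (v 1) (v 2) (v 3) (v 4)) := by
    unfold coeffForm; fun_prop
  have h1 := isBigO_comp_vec_sub hΦ hr
    (x := fun j n => shiftTaylor t ((j : ℝ) - 2) (cbrt (n + 2))⁻¹)
    (y := fun j n => beta t (n + j) / cbrt (n + 2))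
    (fun j => tendsto_shiftTaylor t _) (tendsto_beta_div t) (beta_sub_shiftTaylor t)
  obtain ⟨F, hF, hFr⟩ := exists_coeffForm_shiftTaylor t
  have h2 := isBigO_pow_of_eq_mul hr hF (Eventually.of_forall fun n => hFr (cbrt (n + 2))⁻¹)
  refine (h1.add h2).congr_left fun n => ?_
  have hm := (cbrt_pos (show 0 < n + 2 by omega)).ne'
  rw [p_eq]
  simp only [Matrix.cons_val, Nat.add_sub_cancel, show n + 2 - 1 = n + 1 by omega,
    show n + 2 + 1 = n + 3 by omega, show n + 2 + 2 = n + 4 by omega]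
  norm_num [coeffForm]
  field_simp

/-- The asymptotic expansion of the subleading coefficient, in fractional powers of `n`. -/
lemma expansion_mul_eq (t : ℝ) {n : ℕ} (hn : 0 < n) :
    (-(3 * (n : ℝ) ^ (4 / 3 : ℝ)) / (4 * (60 : ℝ) ^ (1 / 3 : ℝ))
          - (n : ℝ) ^ (2 / 3 : ℝ) * t / (2 * (450 : ℝ) ^ (1 / 3 : ℝ))
          + (n : ℝ) ^ (1 / 3 : ℝ) / (2 * (60 : ℝ) ^ (1 / 3 : ℝ))
          - t ^ 2 / 90
          + t / (6 * (450 : ℝ) ^ (1 / 3 : ℝ) * (n : ℝ) ^ (1 / 3 : ℝ))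
          - (2 * t ^ 3 - 45) / (810 * (60 : ℝ) ^ (1 / 3 : ℝ) * (n : ℝ) ^ (2 / 3 : ℝ))
          + t ^ 4 / (2430 * (450 : ℝ) ^ (1 / 3 : ℝ) * (n : ℝ) ^ (4 / 3 : ℝ))
          - (4 * t ^ 3 - 135) / (4860 * (60 : ℝ) ^ (1 / 3 : ℝ) * (n : ℝ) ^ (5 / 3 : ℝ)))
      * (cbrt n)⁻¹ ^ 4 = scaledExpansion t (cbrt n)⁻¹ := by
  set c : ℝ := (60 : ℝ) ^ (1 / 3 : ℝ) with hc
  set m := cbrt n with hm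
  have hc0 : 0 < c := by positivity
  have hm0 : 0 < m := cbrt_pos hn
  have hc3 : c ^ 3 = 60 := by
    rw [hc, ← Real.rpow_natCast, ← Real.rpow_mul (by norm_num)]; norm_num
  have h1 : (n : ℝ) ^ (1 / 3 : ℝ) = c * m := by
    rw [hc, hm, cbrt, ← Real.mul_rpow (by norm_num) (by positivity)]
    congr 1; ring
  have hpow (k : ℕ) : (n : ℝ) ^ ((k : ℝ) / 3) = (c * m) ^ k := by
    rw [← h1, ← Real.rpow_natCast, ← Real.rpow_mul (Nat.cast_nonneg _)]
    congr 1; ring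
  have h2 : (n : ℝ) ^ (2 / 3 : ℝ) = (c * m) ^ 2 := by exact_mod_cast hpow 2
  have h4 : (n : ℝ) ^ (4 / 3 : ℝ) = (c * m) ^ 4 := by exact_mod_cast hpow 4
  have h5 : (n : ℝ) ^ (5 / 3 : ℝ) = (c * m) ^ 5 := by exact_mod_cast hpow 5
  -- 450 = 60²/8, so both radicals are expressed through c = 60^{1/3}.
  have h450 : (450 : ℝ) ^ (1 / 3 : ℝ) = c ^ 2 / 2 := by
    have h8 : (450 : ℝ) = (c ^ 2 / 2) ^ 3 := by
      rw [div_pow, ← pow_mul, mul_comm, pow_mul, hc3]; norm_num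
    rw [h8, ← Real.rpow_natCast, ← Real.rpow_mul (by positivity)]
    norm_num
  rw [h1, h2, h4, h5, h450, scaledExpansion]
  have e4 : (c * m) ^ 4 = 60 * c * m ^ 4 := by rw [mul_pow, show c ^ 4 = c ^ 3 * c by ring, hc3]
  have e5 : (c * m) ^ 5 = 60 * c ^ 2 * m ^ 5 := by
    rw [mul_pow, show c ^ 5 = c ^ 3 * c ^ 2 by ring, hc3]
  have k3 : c * (c * m) ^ 2 = 60 * m ^ 2 := by rw [mul_pow, ← mul_assoc, ← pow_succ', hc3]
  have k4 : c ^ 2 / 2 * (c * m) = 30 * m := by linear_combination m / 2 * hc3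
  have k5 : c ^ 2 / 2 * (c * m) ^ 4 = 1800 * m ^ 4 := by
    rw [e4]; linear_combination 30 * m ^ 4 * hc3
  have k6 : c * (c * m) ^ 5 = 3600 * m ^ 5 := by rw [e5]; linear_combination 60 * m ^ 5 * hc3
  rw [mul_assoc 6, k4, mul_assoc 810, k3, mul_assoc 2430, k5, mul_assoc 4860, k6, e4]
  field_simp
  ring

end SexticFreud

theorem mainTheorem6 (t : ℝ) :
    (∀ n : ℕ,
      SexticFreud.p n t =
        1 / 2 * SexticFreud.beta t n *
          (1 + 2 * t * SexticFreud.beta t n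
            - 6 * SexticFreud.beta t n ^ 2
                * (SexticFreud.beta t (n - 1) + SexticFreud.beta t n + SexticFreud.beta t (n + 1))
            - 6 * (SexticFreud.beta t n + SexticFreud.beta t (n + 1)) * SexticFreud.beta t (n - 1)
                * (SexticFreud.beta t (n - 2) + SexticFreud.beta t (n - 1) + SexticFreud.beta t n)
            - 6 * (SexticFreud.beta t (n - 1) + SexticFreud.beta t n) * SexticFreud.beta t (n + 1)
                * (SexticFreud.beta t n + SexticFreud.beta t (n + 1)
                    + SexticFreud.beta t (n + 2)))) ∧
    (fun n : ℕ =>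
      SexticFreud.p n t -
        (-(3 * (n : ℝ) ^ (4 / 3 : ℝ)) / (4 * (60 : ℝ) ^ (1 / 3 : ℝ))
          - (n : ℝ) ^ (2 / 3 : ℝ) * t / (2 * (450 : ℝ) ^ (1 / 3 : ℝ))
          + (n : ℝ) ^ (1 / 3 : ℝ) / (2 * (60 : ℝ) ^ (1 / 3 : ℝ))
          - t ^ 2 / 90
          + t / (6 * (450 : ℝ) ^ (1 / 3 : ℝ) * (n : ℝ) ^ (1 / 3 : ℝ))
          - (2 * t ^ 3 - 45) / (810 * (60 : ℝ) ^ (1 / 3 : ℝ) * (n : ℝ) ^ (2 / 3 : ℝ))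
          + t ^ 4 / (2430 * (450 : ℝ) ^ (1 / 3 : ℝ) * (n : ℝ) ^ (4 / 3 : ℝ))
          - (4 * t ^ 3 - 135) / (4860 * (60 : ℝ) ^ (1 / 3 : ℝ) * (n : ℝ) ^ (5 / 3 : ℝ))))
      =O[atTop] fun n : ℕ => 1 / (n : ℝ) ^ 2 := by
  refine ⟨fun n => ?_, ?_⟩
  · rw [SexticFreud.p_eq]
    unfold SexticFreud.coeffForm
    ring
  -- The shift by 2 matches the estimates, which are stated at the middle n + 2 of the window n, …,
  -- n + 4.
  · rw [← map_add_atTop_eq_nat 2, isBigO_map]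
    have h1 := (isBigO_refl (fun n => SexticFreud.cbrt (n + 2) ^ 4) atTop).mul
      (SexticFreud.scaled_p_sub_scaledExpansion t)
    refine (h1.congr' ?_ EventuallyEq.rfl).trans ?_
    · refine Eventually.of_forall fun n => ?_
      have hm := (SexticFreud.cbrt_pos (show 0 < n + 2 by omega)).ne'
      simp only [Function.comp_apply]
      rw [← SexticFreud.expansion_mul_eq t (show 0 < n + 2 by omega), ← sub_mul]
      field_simp
    -- Undoing the scaling, r^{-4} · r^10 = (r³)² = 60²/(n + 2)².
    · refine SexticFreud.isBigO_of_eq_mul (tendsto_const_nhds (x := (60 : ℝ) ^ 2))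
        (Eventually.of_forall fun n => ?_)
      have hm := (SexticFreud.cbrt_pos (show 0 < n + 2 by omega)).ne'
      have h3 := SexticFreud.inv_cbrt_pow_three (n + 2)
      simp only [Function.comp_apply]
      have h4 : SexticFreud.cbrt (n + 2) ^ 4 * (SexticFreud.cbrt (n + 2))⁻¹ ^ 10
          = ((SexticFreud.cbrt (n + 2))⁻¹ ^ 3) ^ 2 := by
        field_simp
      rw [h4, h3, div_pow]
      ring
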